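/- Let $H$ be a complex Hilbert space and $\gamma$ a unitary operator on $H$. Call a family $(A(x))_{x\in X}$, indexed by a topological space $X$, of (possibly unbounded) operators in $H$ *admissible* (for $\gamma$) if every $A(x)$ is self-adjoint and Fredholm, every $A(x)$ commutes with $\gamma$ (i.e. $\gamma$ and $\gamma^{-1}$ preserve $\operatorname{dom}A(x)$ and $A(x)\gamma=\gamma A(x)$ there), and $x\mapsto A(x)$ is continuous for the gap metric $d(S,T)=\|P_{\operatorname{graph}S}-P_{\operatorname{graph}T}\|$, where $P_G$ is the orthogonal projection of $H\oplus H$ onto $G$. For a self-adjoint operator $T$ and a Borel set $I\subseteq\mathbb R$ let $P_I(T)=\chi_I(T)$ be the spectral projection and $E_I(T)$ its range. For an admissible family $A=(A(t))_{t\in[0,1]}$, a *flow partition* consists of $0=t_0<t_1<\dots<t_n=1$ and numbers $a_1,\dots,a_n\ge 0$ such that, for each $k$, $P_{[-a_k,a_k]}(A(t))$ has finite rank and is norm continuous in $t$ for $t\in[t_{k-1},t_k]$. The $\gamma$-spectral flow of $A$ is $$\operatorname{sf}_\gamma(A)=\sum_{k=1}^n\Big(\operatorname{tr}\big(\gamma|_{E_{[0,a_k]}(A(t_k))}\big)-\operatorname{tr}\big(\gamma|_{E_{[0,a_k]}(A(t_{k-1}))}\big)\Big)$$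 for any flow partition of $A$. **Theorem.** Every admissible family $A=(A(t))_{t\in[0,1]}$ has a flow partition, and $\operatorname{sf}_\gamma(A)$ does not depend on its choice. Moreover, the $\gamma$-spectral flow has the following properties. 1. If $A$ is admissible and every $A(t)$ is invertible (a bijection from its domain onto $H$), then $\operatorname{sf}_\gamma(A)=0$. 2. If $A$ is an admissible family on $[0,1]$ in $H$ for $\gamma$, and $B$ is an admissible family on $[0,1]$ in a complex Hilbert space $K$ for a unitary $\delta$ on $K$, then $A\oplus B=(A(t)\oplus B(t))_{t\in[0,1]}$ is admissible in $H\oplus K$ for $\gamma\oplus\delta$, and $\operatorname{sf}_{\gamma\oplus\delta}(A\oplus B)=\operatorname{sf}_\gamma(A)+\operatorname{sf}_\delta(B)$. 3. If $(A(t,s))_{(t,s)\in[0,1]^2}$ is an admissible family such that $A(0,s)$ and $A(1,s)$ do not depend on $s$, then $\operatorname{sf}_\gamma(A(\cdot,1))=\operatorname{sf}_\gamma(A(\cdot,0))$. 4. If $H$ is finite-dimensional and $A$ is admissible on $[0,1]$, then $\operatorname{sf}_\gamma(A)=\operatorname{tr}\big(\gamma|_{E_{(-\infty,0)}(A(0))}\big)-\operatorname{tr}\big(\gamma|_{E_{(-\infty,0)}(A(1))}\big)$.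 5. If $A$ and $B$ are admissible on $[0,1]$ in $H$ with $A(1)=B(0)$, then the concatenation $A*B$, given by $(A*B)(t)=A(2t)$ for $t\le\frac12$ and $(A*B)(t)=B(2t-1)$ for $t>\frac12$, is admissible and $\operatorname{sf}_\gamma(A*B)=\operatorname{sf}_\gamma(A)+\operatorname{sf}_\gamma(B)$. -/

import Mathlib

noncomputable section

namespace SpectralFlow

universe u v

section Operators

variable {H : Type u} [NormedAddCommGroup H] [InnerProductSpace ℂ H]

/-- An unbounded operator is Fredholm if it is closed and densely defined, has finite-dimensional
kernel, and has closed range of finite codimension. -/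
structure IsFredholm (A : H →ₗ.[ℂ] H) : Prop where
  isClosed : A.IsClosed
  dense : Dense (A.domain : Set H)
  finite_ker : FiniteDimensional ℂ (LinearMap.ker A.toFun)
  isClosed_range : IsClosed (LinearMap.range A.toFun : Set H)
  finite_coker : FiniteDimensional ℂ (H ⧸ LinearMap.range A.toFun)

/-- The (possibly unbounded) operator `A` commutes with the unitary operator `γ`: both `γ` and
`γ⁻¹` preserve the domain of `A`, and `A γ = γ A` there. -/
structure Commutes (γ : H ≃ₗᵢ[ℂ] H) (A : H →ₗ.[ℂ] H) : Prop where
  mem_domain_iff : ∀ x : H, γ x ∈ A.domain ↔ x ∈ A.domain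
  map_apply : ∀ (x : H) (hx : x ∈ A.domain) (hγx : γ x ∈ A.domain),
    A ⟨γ x, hγx⟩ = γ (A ⟨x, hx⟩)

/-- `R` is the bounded operator `(A + i)⁻¹`: for every `x` the vector `R x` lies in the domain of
`A` with `A (R x) = x - i R x`, and `R (A x + i x) = x` for every `x` in the domain. -/
def IsResolvent (A : H →ₗ.[ℂ] H) (R : H →L[ℂ] H) : Prop :=
  (∀ x : H, (R x, x - Complex.I • R x) ∈ A.graph) ∧
    ∀ x : A.domain, R (A x + Complex.I • (x : H)) = x

open Classical in
/-- The bounded operator `(A + i)⁻¹`. It exists (and is unique) for every self-adjoint `A`; the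
value `0` for operators without such an inverse is not used. -/
def invAddI (A : H →ₗ.[ℂ] H) : H →L[ℂ] H :=
  if h : ∃ R : H →L[ℂ] H, IsResolvent A R then h.choose else 0

open Classical in
/-- The trace of the restriction of `T` to an invariant (finite-dimensional) subspace `E`. -/
def traceOn (T : H →ₗ[ℂ] H) (E : Submodule ℂ H) : ℂ :=
  if h : ∀ x ∈ E, T x ∈ E then LinearMap.trace ℂ E (T.restrict h) else 0

variable [CompleteSpace H]

/-- The graph of `A`, as a closed subspace of the Hilbert space `H ⊕ H`. (The closure changes
nothing for a closed operator, in particular for a self-adjoint one.) -/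
def closedGraph (A : H →ₗ.[ℂ] H) : Submodule ℂ (WithLp 2 (H × H)) :=
  (A.graph.map (WithLp.linearEquiv 2 ℂ (H × H)).symm.toLinearMap).topologicalClosure

instance (A : H →ₗ.[ℂ] H) : CompleteSpace (closedGraph A) :=
  (Submodule.isClosed_topologicalClosure _).completeSpace_coe

/-- The gap metric: the operator-norm distance between the orthogonal projections of `H ⊕ H` onto
the graphs of the two operators. -/
def gapDist (A B : H →ₗ.[ℂ] H) : ℝ :=
  ‖(closedGraph A).starProjection - (closedGraph B).starProjection‖

/-- Continuity of a family of operators with respect to the gap metric. -/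
def GapContinuous {X : Type*} [TopologicalSpace X] (A : X → H →ₗ.[ℂ] H) : Prop :=
  ∀ x : X, Filter.Tendsto (fun y => gapDist (A y) (A x)) (nhds x) (nhds 0)

/-- The continuous functional calculus `f ↦ f(A)` of a self-adjoint operator `A`, for continuous
functions `f : ℝ → ℂ` vanishing at infinity. It is obtained from the continuous functional calculus
of the bounded normal operator `(A + i)⁻¹`: the point `s` of the spectrum of `A` corresponds to
the point `z = (s + i)⁻¹`, so that `s = Re z⁻¹`, and infinity corresponds to `z = 0`. -/
def functionalCalculus (A : H →ₗ.[ℂ] H) (f : ZeroAtInftyContinuousMap ℝ ℂ) : H →L[ℂ] H :=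
  cfc (fun z : ℂ => if z = 0 then 0 else f (z⁻¹).re) (invAddI A)

/-- The range of the spectral projection `χ_K(A)` for a closed set `K`: the vectors whose spectral
measure with respect to `A` is supported in `K`, i.e. those annihilated by `f(A)` for every `f`
that vanishes on `K`. -/
def closedSpectralSubspace (A : H →ₗ.[ℂ] H) (K : Set ℝ) : Submodule ℂ H :=
  ⨅ (f : ZeroAtInftyContinuousMap ℝ ℂ) (_ : ∀ s ∈ K, f s = 0),
    LinearMap.ker (functionalCalculus A f).toLinearMap

/-- The spectral subspace `E_S(A)` of a self-adjoint operator `A` for a Borel set `S ⊆ ℝ`, i.e. the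
range of the spectral projection `χ_S(A)`. For closed `S` it is `closedSpectralSubspace A S`; for
general `S` it is the closed span of the spectral subspaces of the closed subsets of `S`, by inner
regularity of the spectral measure. -/
def spectralSubspace (A : H →ₗ.[ℂ] H) (S : Set ℝ) : Submodule ℂ H :=
  (⨆ (K : Set ℝ) (_ : IsClosed K ∧ K ⊆ S), closedSpectralSubspace A K).topologicalClosure

instance (A : H →ₗ.[ℂ] H) (S : Set ℝ) : CompleteSpace (spectralSubspace A S) :=
  (Submodule.isClosed_topologicalClosure _).completeSpace_coe

/-- The spectral projection `P_S(A) = χ_S(A)`. -/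
def spectralProjection (A : H →ₗ.[ℂ] H) (S : Set ℝ) : H →L[ℂ] H :=
  (spectralSubspace A S).starProjection

/-- A gap-continuous family of self-adjoint Fredholm operators commuting with `γ`. -/
structure IsFredholmFamily {X : Type*} [TopologicalSpace X] (γ : H ≃ₗᵢ[ℂ] H)
    (A : X → H →ₗ.[ℂ] H) : Prop where
  selfAdjoint : ∀ x, IsSelfAdjoint (A x)
  fredholm : ∀ x, IsFredholm (A x)
  commutes : ∀ x, Commutes γ (A x)
  gapContinuous : GapContinuous A

/-- A flow partition of a family `A`: a partition `0 = t 0 < ⋯ < t n = 1` and numbers `a k ≥ 0`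
such that on the `k`-th subinterval the spectral projection of `A s` for `[-a k, a k]` has finite
rank and is norm continuous in `s`. -/
structure FlowPartition (A : unitInterval → H →ₗ.[ℂ] H) where
  n : ℕ
  t : Fin (n + 1) → unitInterval
  a : Fin n → ℝ
  strictMono : StrictMono t
  t_zero : t 0 = 0
  t_last : t (Fin.last n) = 1
  a_nonneg : ∀ k, 0 ≤ a k
  finite : ∀ k, ∀ s ∈ Set.Icc (t k.castSucc) (t k.succ),
    FiniteDimensional ℂ (spectralSubspace (A s) (Set.Icc (-a k) (a k)))
  continuousOn : ∀ k, ContinuousOn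
    (fun s => spectralProjection (A s) (Set.Icc (-a k) (a k)))
    (Set.Icc (t k.castSucc) (t k.succ))

/-- The `γ`-spectral flow computed with a given flow partition:
`∑ₖ tr(γ | E_[0, aₖ](A(tₖ))) - tr(γ | E_[0, aₖ](A(tₖ₋₁)))`. -/
def FlowPartition.flow {A : unitInterval → H →ₗ.[ℂ] H} (p : FlowPartition A) (γ : H ≃ₗᵢ[ℂ] H) : ℂ :=
  ∑ k : Fin p.n,
    (traceOn γ.toLinearMap (spectralSubspace (A (p.t k.succ)) (Set.Icc 0 (p.a k))) -
      traceOn γ.toLinearMap (spectralSubspace (A (p.t k.castSucc)) (Set.Icc 0 (p.a k))))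

open Classical in
/-- The `γ`-spectral flow of the family `A`, computed with some flow partition. -/
def sf (γ : H ≃ₗᵢ[ℂ] H) (A : unitInterval → H →ₗ.[ℂ] H) : ℂ :=
  if h : Nonempty (FlowPartition A) then h.some.flow γ else 0

end Operators

section Constructions

variable {H : Type u} [NormedAddCommGroup H] [InnerProductSpace ℂ H]
variable {K : Type v} [NormedAddCommGroup K] [InnerProductSpace ℂ K]

/-- The direct sum `A ⊕ B` of unbounded operators, acting in the Hilbert space `H ⊕ K` with domain
`dom A ⊕ dom B`. -/
def directSum (A : H →ₗ.[ℂ] H) (B : K →ₗ.[ℂ] K) :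
    WithLp 2 (H × K) →ₗ.[ℂ] WithLp 2 (H × K) where
  domain := (A.domain.prod B.domain).comap (WithLp.linearEquiv 2 ℂ (H × K)).toLinearMap
  toFun :=
    { toFun := fun x => WithLp.toLp 2 (A ⟨x.1.fst, x.2.1⟩, B ⟨x.1.snd, x.2.2⟩)
      map_add' := fun x y => by
        rw [← WithLp.toLp_add, Prod.mk_add_mk, ← A.map_add, ← B.map_add]
        rfl
      map_smul' := fun c x => by
        rw [RingHom.id_apply, ← WithLp.toLp_smul, Prod.smul_mk, ← A.map_smul, ← B.map_smul]
        rfl }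

/-- The concatenation of two paths: first `A` on `[0, 1/2]`, then `B` on `[1/2, 1]`, each at
double speed. -/
def concat (A B : unitInterval → H →ₗ.[ℂ] H) : unitInterval → H →ₗ.[ℂ] H := fun t =>
  if (t : ℝ) ≤ 1 / 2 then A (Set.projIcc 0 1 zero_le_one (2 * (t : ℝ)))
  else B (Set.projIcc 0 1 zero_le_one (2 * (t : ℝ) - 1))

end Constructions

end SpectralFlow

end

set_option linter.unusedSectionVars false

noncomputable section

namespace SpectralFlow

open scoped InnerProductSpace ZeroAtInfty Topology
open Filter

universe u v

/-! ### The bounded operators `(1 + A²)⁻¹`, `A (1 + A²)⁻¹` and `(A + i)⁻¹` -/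

section Resolvent

variable {H : Type u} [NormedAddCommGroup H] [InnerProductSpace ℂ H] [CompleteSpace H]
  {A : H →ₗ.[ℂ] H}

/-! Partitions are replaced by a single function on the parameter space. Call `Φ` a flow potential
if, near each point and for all small `c > 0`, `Φ` minus the trace of `γ` on `E_[0,c]` is constant.
Two potentials differ by a locally constant function, so on a connected space they have the same
increments (`IsFlowPotential.sub_eq`). Every flow partition produces a potential whose total
increment is its flow (`FlowPartition.exists_isFlowPotential`). This gives independence of the
partition, and reduces the properties of the spectral flow to exhibiting suitable potentials.

The analytic input is as follows. The entries of the graph projection determine `(A + i)⁻¹`, so gap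
continuity makes `f(A)` norm continuous for every `f` in `C₀(ℝ)`. A self-adjoint Fredholm operator
has `0` as at most an isolated spectral point (`exists_spectralGap`). If `±c` lies in the gap, a
continuous cutoff `f` satisfies `f(A) = P_[-c,c](A)`, with the same `f` for all nearby operators;
these projections are therefore continuous and of finite rank (`exists_finite_continuousAt`), and
compactness of the interval yields a flow partition.

The crux is `eventually_spectralTrace_sub`: where `P_[-a,a]` is continuous and of finite rank, the
traces for `[0,a]` and for small `[0,c]` differ by a locally constant function. A complement of
`E_[0,c]` in `E_[0,a]` is the range of a continuous family of idempotents commuting with `γ`, and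
nearby idempotents of this kind are conjugate by an operator commuting with `γ`
(`eventually_exists_equiv`). The endpoints `±a` may belong to the spectrum, and `a = 0` is allowed.
-/

lemma mem_closedGraph (hA : A.IsClosed) {z : WithLp 2 (H × H)} :
    z ∈ closedGraph A ↔ (z.fst, z.snd) ∈ A.graph := by
  have hc : IsClosed (A.graph.map (WithLp.linearEquiv 2 ℂ (H × H)).symm.toLinearMap :
      Set (WithLp 2 (H × H))) := by
    rw [Submodule.map_coe]
    exact (WithLp.prodContinuousLinearEquiv 2 ℂ H H).symm.toHomeomorph.isClosedMap _ hA
  rw [closedGraph, hc.submodule_topologicalClosure_eq, Submodule.mem_map]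
  constructor
  · rintro ⟨y, hy, rfl⟩
    exact hy
  · intro h
    exact ⟨_, h, rfl⟩

lemma graph_symm (hA : IsSelfAdjoint A) {x y : H × H} (hx : x ∈ A.graph) (hy : y ∈ A.graph) :
    ⟪x.2, y.1⟫_ℂ = ⟪x.1, y.2⟫_ℂ := by
  obtain ⟨a, ha, ha'⟩ := (LinearPMap.mem_graph_iff A).1 hx
  obtain ⟨b, hb, hb'⟩ := (LinearPMap.mem_graph_iff A).1 hy
  have := LinearPMap.adjoint_isFormalAdjoint hA.dense_domain
  rw [LinearPMap.isSelfAdjoint_def.1 hA] at this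
  rw [← ha, ← ha', ← hb, ← hb']
  exact this a b

lemma mem_graph_of_forall_inner (hA : IsSelfAdjoint A) {y w : H}
    (h : ∀ x ∈ A.graph, ⟪w, x.1⟫_ℂ = ⟪y, x.2⟫_ℂ) : (y, w) ∈ A.graph := by
  have h' : ∀ x : A.domain, ⟪w, (x : H)⟫_ℂ = ⟪y, A x⟫_ℂ := fun x => h _ (A.mem_graph x)
  have hy : y ∈ (LinearPMap.adjoint A).domain := LinearPMap.mem_adjoint_domain_of_exists y ⟨w, h'⟩
  have h2 := LinearPMap.adjoint_apply_eq hA.dense_domain ⟨y, hy⟩ h'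
  have h3 := (LinearPMap.adjoint A).mem_graph ⟨y, hy⟩
  have h4 : (y, w) ∈ (LinearPMap.adjoint A).graph := h2 ▸ h3
  rwa [LinearPMap.isSelfAdjoint_def.1 hA] at h4

/-- The operator `(1 + A²)⁻¹`, a matrix entry of the projection onto the graph of `A`. -/
def resolventS (A : H →ₗ.[ℂ] H) : H →L[ℂ] H :=
  WithLp.fstL 2 ℂ H H ∘L (closedGraph A).starProjection ∘L
    (WithLp.prodContinuousLinearEquiv 2 ℂ H H).symm.toContinuousLinearMap ∘L
      ContinuousLinearMap.inl ℂ H H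

/-- The operator `A (1 + A²)⁻¹`, a matrix entry of the projection onto the graph of `A`. -/
def resolventT (A : H →ₗ.[ℂ] H) : H →L[ℂ] H :=
  WithLp.sndL 2 ℂ H H ∘L (closedGraph A).starProjection ∘L
    (WithLp.prodContinuousLinearEquiv 2 ℂ H H).symm.toContinuousLinearMap ∘L
      ContinuousLinearMap.inl ℂ H H

lemma resolventS_apply (x : H) :
    resolventS A x = ((closedGraph A).starProjection (WithLp.toLp 2 (x, 0))).fst := rfl

lemma resolventT_apply (x : H) :
    resolventT A x = ((closedGraph A).starProjection (WithLp.toLp 2 (x, 0))).snd := rfl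

lemma mem_graph_S (hA : IsSelfAdjoint A) (x : H) : (resolventS A x, resolventT A x) ∈ A.graph :=
  (mem_closedGraph hA.isClosed).1 (Submodule.starProjection_apply_mem _ _)

lemma mem_graph_T (hA : IsSelfAdjoint A) (x : H) :
    (resolventT A x, x - resolventS A x) ∈ A.graph := by
  refine mem_graph_of_forall_inner hA fun y hy => ?_
  have := Submodule.starProjection_inner_eq_zero (K := closedGraph A) (WithLp.toLp 2 (x, (0 : H)))
    (WithLp.toLp 2 y) ((mem_closedGraph hA.isClosed).2 hy)
  rw [WithLp.prod_inner_apply] at this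
  simp only [WithLp.ofLp_sub, Prod.fst_sub, Prod.snd_sub, zero_sub, inner_neg_left] at this
  exact sub_eq_zero.1 ((sub_eq_add_neg _ _).trans this)

/-- By self-adjointness the orthogonal complement of the graph is the graph rotated by a right
angle, so `(x, 0) = (u, v) + (x - u, -v)` is the orthogonal decomposition. Identities between
`resolventS` and `resolventT` thereby become memberships in the graph. -/
lemma eq_of_mem_graph (hA : IsSelfAdjoint A) {x u v : H} (h1 : (u, v) ∈ A.graph)
    (h2 : (v, x - u) ∈ A.graph) : resolventS A x = u ∧ resolventT A x = v := by
  have : (closedGraph A).starProjection (WithLp.toLp 2 (x, (0 : H))) = WithLp.toLp 2 (u, v) := by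
    refine Submodule.eq_starProjection_of_mem_of_inner_eq_zero
      ((mem_closedGraph hA.isClosed).2 h1) fun w hw => ?_
    have := graph_symm hA h2 ((mem_closedGraph hA.isClosed).1 hw)
    rw [WithLp.prod_inner_apply]
    simp only [WithLp.ofLp_sub, Prod.fst_sub, Prod.snd_sub, zero_sub, inner_neg_left]
    exact (sub_eq_add_neg _ _).symm.trans (sub_eq_zero.2 this)
  rw [resolventS_apply, resolventT_apply, this]
  exact ⟨rfl, rfl⟩

lemma resolventS_comm (hA : IsSelfAdjoint A) (x : H) :
    resolventS A (resolventT A x) = resolventT A (resolventS A x) ∧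
    resolventT A (resolventT A x) = resolventS A x - resolventS A (resolventS A x) :=
  -- Applied to the vector `T x`, with `u = T S x` and `v = S x - S² x`.
  eq_of_mem_graph hA (mem_graph_T hA _)
    (A.graph.sub_mem (mem_graph_S hA x) (mem_graph_S hA (resolventS A x)))

lemma isSelfAdjoint_resolventT (hA : IsSelfAdjoint A) : IsSelfAdjoint (resolventT A) := by
  rw [ContinuousLinearMap.isSelfAdjoint_iff_isSymmetric]
  intro x y
  have h1 := graph_symm hA (mem_graph_S hA x) (mem_graph_S hA y)
  have h2 := graph_symm hA (mem_graph_T hA x) (mem_graph_T hA y)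
  simp only [inner_sub_left, inner_sub_right] at h1 h2
  simp only [ContinuousLinearMap.coe_coe]
  linear_combination h1 - h2

lemma isSelfAdjoint_resolventS (hA : IsSelfAdjoint A) : IsSelfAdjoint (resolventS A) := by
  rw [ContinuousLinearMap.isSelfAdjoint_iff_isSymmetric]
  intro x y
  have h1 := graph_symm hA (mem_graph_T hA x) (mem_graph_S hA y)
  have h2 := graph_symm hA (mem_graph_S hA x) (mem_graph_T hA y)
  simp only [inner_sub_left, inner_sub_right] at h1 h2
  simp only [ContinuousLinearMap.coe_coe]
  linear_combination -h1 - h2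

/-- A symmetric operator has no eigenvalue `-i`, because `⟪A x, x⟫` is real. -/
lemma eq_zero_of_mem_graph (hA : IsSelfAdjoint A) {x : H} (h : (x, -(Complex.I • x)) ∈ A.graph) :
    x = 0 := by
  have := graph_symm hA h h
  simp only [inner_neg_left, inner_neg_right, inner_smul_left, inner_smul_right,
    Complex.conj_I] at this
  have h2 : (2 * Complex.I) * ⟪x, x⟫_ℂ = 0 := by linear_combination this
  simpa using h2

lemma isResolvent (hA : IsSelfAdjoint A) :
    IsResolvent A (resolventT A - Complex.I • resolventS A) := by
  have h1 : ∀ x : H, ((resolventT A - Complex.I • resolventS A) x,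
      x - Complex.I • (resolventT A - Complex.I • resolventS A) x) ∈ A.graph := by
    intro x
    convert! A.graph.sub_mem (mem_graph_T hA x) (A.graph.smul_mem Complex.I (mem_graph_S hA x))
      using 1
    simp [smul_sub, smul_smul, Prod.ext_iff]
    abel
  refine ⟨h1, fun x => ?_⟩
  rw [← sub_eq_zero]
  refine eq_zero_of_mem_graph hA ?_
  convert! A.graph.sub_mem (h1 (A x + Complex.I • (x : H))) (A.mem_graph x) using 1
  simp only [Prod.mk_sub_mk, Prod.mk.injEq, true_and, smul_sub]
  abel

lemma IsResolvent.eq {R R' : H →L[ℂ] H} (h : IsResolvent A R) (h' : IsResolvent A R') :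
    R = R' := by
  ext x
  obtain ⟨y, hy, hy'⟩ := (LinearPMap.mem_graph_iff A).1 (h'.1 x)
  have := h.2 y
  rw [hy', hy] at this
  simpa using this

lemma invAddI_eq_of_isResolvent {R : H →L[ℂ] H} (h : IsResolvent A R) : invAddI A = R := by
  have hex : ∃ R : H →L[ℂ] H, IsResolvent A R := ⟨R, h⟩
  rw [invAddI, dif_pos hex]
  exact hex.choose_spec.eq h

lemma invAddI_eq (hA : IsSelfAdjoint A) :
    invAddI A = resolventT A - Complex.I • resolventS A :=
  invAddI_eq_of_isResolvent (isResolvent hA)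

lemma isResolvent_invAddI (hA : IsSelfAdjoint A) : IsResolvent A (invAddI A) :=
  invAddI_eq hA ▸ isResolvent hA

lemma star_invAddI (hA : IsSelfAdjoint A) :
    star (invAddI A) = resolventT A + Complex.I • resolventS A := by
  rw [invAddI_eq hA, star_sub, star_smul, (isSelfAdjoint_resolventT hA).star_eq,
    (isSelfAdjoint_resolventS hA).star_eq]
  simp

lemma resolvent_mul (hA : IsSelfAdjoint A) :
    resolventS A * resolventT A = resolventT A * resolventS A ∧
    resolventT A * resolventT A = resolventS A - resolventS A * resolventS A :=
  ⟨ContinuousLinearMap.ext fun x => (resolventS_comm hA x).1,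
    ContinuousLinearMap.ext fun x => (resolventS_comm hA x).2⟩

lemma star_mul_invAddI (hA : IsSelfAdjoint A) :
    star (invAddI A) * invAddI A = resolventS A := by
  obtain ⟨h1, h2⟩ := resolvent_mul hA
  rw [star_invAddI hA, invAddI_eq hA]
  simp only [add_mul, mul_sub, smul_mul_assoc, mul_smul_comm, h1, h2]
  match_scalars <;> ring_nf <;> simp

lemma isStarNormal_invAddI (hA : IsSelfAdjoint A) : IsStarNormal (invAddI A) := by
  constructor
  rw [commute_iff_eq, star_mul_invAddI hA]
  obtain ⟨h1, h2⟩ := resolvent_mul hA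
  rw [star_invAddI hA, invAddI_eq hA]
  simp only [sub_mul, mul_add, smul_mul_assoc, mul_smul_comm, h1, h2]
  match_scalars <;> ring_nf <;> simp

/-- This is the equation of `resolventCircle` with the operator in place of `z`; spectral mapping
then puts the spectrum on that circle. -/
lemma star_invAddI_sub (hA : IsSelfAdjoint A) :
    star (invAddI A) - invAddI A = (2 * Complex.I) • (star (invAddI A) * invAddI A) := by
  rw [star_mul_invAddI hA, star_invAddI hA, invAddI_eq hA]
  module

lemma invAddI_injective (hA : IsSelfAdjoint A) : Function.Injective (invAddI A) := by
  rw [injective_iff_map_eq_zero]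
  intro x hx
  have := (isResolvent_invAddI hA).1 x
  rw [hx, smul_zero, sub_zero] at this
  exact A.graph_fst_eq_zero_snd this rfl

end Resolvent

/-! ### Transport of `C₀(ℝ)` to the circle of resolvent values -/

section Circle

/-- The image of the extended real line under `s ↦ (s + i)⁻¹`. -/
def resolventCircle : Set ℂ := {z | star z - z = 2 * Complex.I * (star z * z)}

lemma isCompact_resolventCircle : IsCompact resolventCircle := by
  refine Metric.isCompact_of_isClosed_isBounded (isClosed_eq (by fun_prop) (by fun_prop)) ?_
  refine (Metric.isBounded_closedBall (x := (0 : ℂ)) (r := 1)).subset fun z hz => ?_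
  rw [mem_closedBall_zero_iff]
  have h := congrArg norm (show star z - z = 2 * Complex.I * (star z * z) from hz)
  have h1 : ‖star z - z‖ ≤ 2 * ‖z‖ := by
    refine (norm_sub_le _ _).trans ?_
    rw [norm_star]
    linarith
  rw [h] at h1
  simp only [norm_mul, Complex.norm_I, norm_star, Complex.norm_ofNat] at h1
  nlinarith [norm_nonneg z]

lemma inv_im_of_mem {z : ℂ} (hz : z ∈ resolventCircle) (h0 : z ≠ 0) : (z⁻¹).im = 1 := by
  have h : star z - z = 2 * Complex.I * (star z * z) := hz
  have h0' : star z ≠ 0 := star_ne_zero.2 h0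
  have h1 : z⁻¹ - star (z⁻¹) = 2 * Complex.I := by
    rw [star_inv₀]
    field_simp
    linear_combination h
  have := congrArg Complex.im h1
  simp only [Complex.sub_im, Complex.star_def, Complex.conj_im, Complex.mul_im, Complex.I_re,
    Complex.I_im, Complex.re_ofNat, Complex.im_ofNat] at this
  linarith

lemma eq_inv_of_mem {z : ℂ} (hz : z ∈ resolventCircle) (h0 : z ≠ 0) :
    z = (((z⁻¹).re : ℂ) + Complex.I)⁻¹ := by
  rw [eq_comm, inv_eq_iff_eq_inv]
  apply Complex.ext <;> simp only [Complex.add_re, Complex.ofReal_re, Complex.I_re, add_zero,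
    Complex.add_im, Complex.ofReal_im, Complex.I_im, zero_add, inv_im_of_mem hz h0]

lemma ofReal_add_I_ne_zero (s : ℝ) : (s : ℂ) + Complex.I ≠ 0 := fun h => by
  simpa using congrArg Complex.im h

open Classical in
/-- A function in `C₀(ℝ)` transported to the circle `resolventCircle`. -/
def circleFun (f : C₀(ℝ, ℂ)) (z : ℂ) : ℂ := if z = 0 then 0 else f (z⁻¹).re

lemma circleFun_zero (f : C₀(ℝ, ℂ)) : circleFun f 0 = 0 := by simp [circleFun]

lemma circleFun_inv (f : C₀(ℝ, ℂ)) (s : ℝ) : circleFun f ((s : ℂ) + Complex.I)⁻¹ = f s := by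
  simp [circleFun, ofReal_add_I_ne_zero]

/-- Only `z = 0` is delicate. Inverses of nonzero points of the circle have imaginary part `1`, so
`|w⁻¹| → ∞` forces `|Re w⁻¹| → ∞`, where `f` decays. -/
lemma continuousOn_circleFun (f : C₀(ℝ, ℂ)) : ContinuousOn (circleFun f) resolventCircle := by
  intro z hz
  by_cases h0 : z = 0
  · subst h0
    rw [ContinuousWithinAt, circleFun_zero]
    rw [Metric.tendsto_nhds]
    intro ε hε
    have hf : ∀ᶠ s in cocompact ℝ, dist (f s) 0 < ε := Metric.tendsto_nhds.1 f.zero_at_infty' ε hε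
    rw [← Metric.cobounded_eq_cocompact, ← comap_norm_atTop, eventually_comap,
      eventually_atTop] at hf
    obtain ⟨r, hr⟩ := hf
    have hinv : ∀ᶠ w in 𝓝[≠] (0 : ℂ), |r| + 1 ≤ ‖w⁻¹‖ :=
      (tendsto_norm_cobounded_atTop.comp tendsto_inv₀_nhdsNE_zero).eventually_ge_atTop _
    rw [eventually_nhdsWithin_iff] at hinv ⊢
    filter_upwards [hinv] with w hw hwm
    by_cases hw0 : w = 0
    · simpa [hw0, circleFun_zero] using hε
    · have h1 := hw hw0
      have him := inv_im_of_mem hwm hw0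
      have h2 : ‖w⁻¹‖ ≤ |(w⁻¹).re| + 1 := by
        have := Complex.norm_le_abs_re_add_abs_im w⁻¹
        rwa [him, abs_one] at this
      have : circleFun f w = f (w⁻¹).re := by simp [circleFun, hw0]
      rw [this]
      refine hr ‖(w⁻¹).re‖ ?_ _ rfl
      rw [Real.norm_eq_abs]
      linarith [le_abs_self r]
  · apply ContinuousAt.continuousWithinAt
    have h : (fun w : ℂ => f (w⁻¹).re) =ᶠ[𝓝 z] circleFun f := by
      filter_upwards [isOpen_ne.mem_nhds h0] with w hw
      exact (if_neg hw).symm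
    refine ContinuousAt.congr ?_ h
    exact f.continuous.continuousAt.comp
      (Complex.continuous_re.continuousAt.comp (continuousAt_inv₀ h0))

/-- The function `s ↦ (s + i)⁻¹`. -/
def invAddIFun : C₀(ℝ, ℂ) where
  toFun s := ((s : ℂ) + Complex.I)⁻¹
  continuous_toFun := by
    refine Continuous.inv₀ (by fun_prop) ofReal_add_I_ne_zero
  zero_at_infty' := by
    rw [← Metric.cobounded_eq_cocompact]
    refine tendsto_inv₀_cobounded.comp ?_
    rw [← tendsto_norm_atTop_iff_cobounded]
    refine tendsto_atTop_mono (fun s => ?_) tendsto_norm_cobounded_atTop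
    have := Complex.abs_re_le_norm ((s : ℂ) + Complex.I)
    simpa using this

@[simp] lemma invAddIFun_apply (s : ℝ) : invAddIFun s = ((s : ℂ) + Complex.I)⁻¹ := rfl

lemma exists_zeroAtInfty {F : ℝ → ℝ} (hF : Continuous F) (v : ℝ) (h : ∀ s, v ≤ |s| → F s = 0) :
    ∃ f : C₀(ℝ, ℂ), ∀ s, f s = F s := by
  refine ⟨⟨⟨fun s => (F s : ℂ), by fun_prop⟩, ?_⟩, fun s => rfl⟩
  refine tendsto_const_nhds.congr' ?_
  filter_upwards [(isCompact_Icc (a := -v) (b := v)).compl_mem_cocompact] with s hs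
  have : v ≤ |s| := by
    by_contra hlt
    exact hs (abs_le.1 (not_le.1 hlt).le)
  simp [h s this]

end Circle

/-! ### Intertwiners of bounded normal operators -/

section Intertwining

variable {H : Type u} [NormedAddCommGroup H] [InnerProductSpace ℂ H] [CompleteSpace H]
  {L : Type v} [NormedAddCommGroup L] [InnerProductSpace ℂ L] [CompleteSpace L]

lemma cfc_eq_cfcHomSuperset {a : H →L[ℂ] H} (ha : IsStarNormal a) {s : Set ℂ}
    (has : spectrum ℂ a ⊆ s) {f : ℂ → ℂ} (hf : ContinuousOn f s) :
    cfc f a = cfcHomSuperset ha has ⟨_, hf.domRestrict⟩ := by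
  rw [cfcHomSuperset_apply, cfc_apply f a ha (hf.mono has)]
  congr!

/-- Both calculi are pulled back to `C(s)` for one compact `s` containing both spectra. The
functions whose calculi are intertwined by `V` form a closed set, stable under sums and products,
that contains the constants, `z` and `z̄`; Stone–Weierstrass finishes. -/
lemma comp_cfc_eq {a : H →L[ℂ] H} {b : L →L[ℂ] L} (ha : IsStarNormal a) (hb : IsStarNormal b)
    {s : Set ℂ} (hs : IsCompact s) (has : spectrum ℂ a ⊆ s) (hbs : spectrum ℂ b ⊆ s)
    {V : H →L[ℂ] L} (h1 : V ∘L a = b ∘L V) (h2 : V ∘L star a = star b ∘L V) {f : ℂ → ℂ}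
    (hf : ContinuousOn f s) : V ∘L cfc f a = cfc f b ∘L V := by
  have : CompactSpace s := isCompact_iff_compactSpace.1 hs
  have key : ∀ g : C(s, ℂ), V ∘L cfcHomSuperset ha has g = cfcHomSuperset hb hbs g ∘L V := by
    intro g
    induction g using ContinuousMap.induction_on_of_compact with
    | const r =>
      conv =>
        enter [1, 2, 2]
        equals algebraMap ℂ _ r => rfl
      conv =>
        enter [2, 1, 2]
        equals algebraMap ℂ _ r => rfl
      rw [AlgHomClass.commutes, AlgHomClass.commutes]
      ext x
      simp [Algebra.algebraMap_eq_smul_one]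
    | id => rwa [cfcHomSuperset_id, cfcHomSuperset_id]
    | star_id => rwa [map_star, map_star, cfcHomSuperset_id, cfcHomSuperset_id]
    | add f g hf hg =>
      rw [map_add, map_add, ContinuousLinearMap.comp_add, ContinuousLinearMap.add_comp, hf, hg]
    | mul f g hf hg =>
      rw [map_mul, map_mul, ContinuousLinearMap.mul_def, ContinuousLinearMap.mul_def,
        ← ContinuousLinearMap.comp_assoc, hf, ContinuousLinearMap.comp_assoc, hg,
        ContinuousLinearMap.comp_assoc]
    | frequently f hf =>
      have hc : IsClosed {f : C(s, ℂ) |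
          V ∘L cfcHomSuperset ha has f = cfcHomSuperset hb hbs f ∘L V} :=
        isClosed_eq (continuous_const.clm_comp (cfcHomSuperset_continuous ha has))
          ((cfcHomSuperset_continuous hb hbs).clm_comp continuous_const)
      exact hc.closure_subset (mem_closure_iff_frequently.2 hf)
  rw [cfc_eq_cfcHomSuperset ha has hf, cfc_eq_cfcHomSuperset hb hbs hf]
  exact key _

end Intertwining

/-! ### Functional calculus and spectral subspaces of an unbounded operator -/

section Calculus

variable {H : Type u} [NormedAddCommGroup H] [InnerProductSpace ℂ H] [CompleteSpace H]
  {A : H →ₗ.[ℂ] H}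

lemma functionalCalculus_eq (f : C₀(ℝ, ℂ)) :
    functionalCalculus A f = cfc (circleFun f) (invAddI A) := by
  rw [functionalCalculus]
  congr 1

lemma spectrum_invAddI_subset (hA : IsSelfAdjoint A) :
    spectrum ℂ (invAddI A) ⊆ resolventCircle := by
  have hn := isStarNormal_invAddI hA
  have h1 : cfc (fun z : ℂ => star z - z - 2 * Complex.I * (star z * z)) (invAddI A) = 0 := by
    rw [cfc_sub (fun z => star z - z) (fun z => 2 * Complex.I * (star z * z)) (invAddI A),
      cfc_sub (fun z => star z) (fun z => z) (invAddI A), cfc_star_id (R := ℂ) (a := invAddI A), cfc_id' ℂ (invAddI A),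
      cfc_const_mul (2 * Complex.I) (fun z => star z * z) (invAddI A),
      cfc_mul (fun z => star z) (fun z => z) (invAddI A), cfc_star_id (R := ℂ) (a := invAddI A), cfc_id' ℂ (invAddI A),
      star_invAddI_sub hA, sub_self]
  intro z hz
  have h2 := cfc_map_spectrum (R := ℂ) (fun z : ℂ => star z - z - 2 * Complex.I * (star z * z))
    (invAddI A)
  have h3 : (fun z : ℂ => star z - z - 2 * Complex.I * (star z * z)) z ∈ spectrum ℂ
      (cfc (fun z : ℂ => star z - z - 2 * Complex.I * (star z * z)) (invAddI A)) := by
    rw [h2]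
    exact ⟨z, hz, rfl⟩
  rw [h1] at h3
  -- On the zero space the spectrum is empty, which contradicts `h3`; otherwise the spectrum of `0`
  -- is `{0}`.
  have : Nontrivial (H →L[ℂ] H) := by
    by_contra hnt
    rw [not_nontrivial_iff_subsingleton] at hnt
    simp at h3
  rw [spectrum.zero_eq] at h3
  exact sub_eq_zero.1 h3

lemma continuousOn_circleFun_spectrum (hA : IsSelfAdjoint A) (f : C₀(ℝ, ℂ)) :
    ContinuousOn (circleFun f) (spectrum ℂ (invAddI A)) :=
  (continuousOn_circleFun f).mono (spectrum_invAddI_subset hA)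

/-- This is how spectral gaps are exploited: functions may be altered freely inside a gap. -/
lemma functionalCalculus_congr (hA : IsSelfAdjoint A) {f g : C₀(ℝ, ℂ)}
    (h : ∀ s : ℝ, ((s : ℂ) + Complex.I)⁻¹ ∈ spectrum ℂ (invAddI A) → f s = g s) :
    functionalCalculus A f = functionalCalculus A g := by
  rw [functionalCalculus_eq, functionalCalculus_eq]
  refine cfc_congr fun z hz => ?_
  by_cases h0 : z = 0
  · simp [h0, circleFun_zero]
  · have := eq_inv_of_mem (spectrum_invAddI_subset hA hz) h0
    rw [this] at hz ⊢
    rw [circleFun_inv, circleFun_inv, h _ hz]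

lemma functionalCalculus_mul (hA : IsSelfAdjoint A) (f g : C₀(ℝ, ℂ)) :
    functionalCalculus A (f * g) = functionalCalculus A f * functionalCalculus A g := by
  simp only [functionalCalculus_eq]
  rw [← cfc_mul (circleFun f) (circleFun g) _ (continuousOn_circleFun_spectrum hA f)
    (continuousOn_circleFun_spectrum hA g)]
  congr 1
  ext z
  by_cases h0 : z = 0 <;> simp [circleFun, h0]

lemma functionalCalculus_sub (hA : IsSelfAdjoint A) (f g : C₀(ℝ, ℂ)) :
    functionalCalculus A (f - g) = functionalCalculus A f - functionalCalculus A g := by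
  simp only [functionalCalculus_eq]
  rw [← cfc_sub (circleFun f) (circleFun g) _ (continuousOn_circleFun_spectrum hA f)
    (continuousOn_circleFun_spectrum hA g)]
  congr 1
  ext z
  by_cases h0 : z = 0 <;> simp [circleFun, h0]

lemma functionalCalculus_smul (hA : IsSelfAdjoint A) (c : ℂ) (f : C₀(ℝ, ℂ)) :
    functionalCalculus A (c • f) = c • functionalCalculus A f := by
  simp only [functionalCalculus_eq]
  rw [← cfc_smul c (circleFun f) _ (continuousOn_circleFun_spectrum hA f)]
  congr 1
  ext z
  by_cases h0 : z = 0 <;> simp [circleFun, h0]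

lemma functionalCalculus_star (f : C₀(ℝ, ℂ)) :
    functionalCalculus A (star f) = star (functionalCalculus A f) := by
  simp only [functionalCalculus_eq]
  rw [← cfc_star]
  congr 1
  ext z
  by_cases h0 : z = 0 <;> simp [circleFun, h0]

lemma functionalCalculus_invAddIFun (hA : IsSelfAdjoint A) :
    functionalCalculus A invAddIFun = invAddI A := by
  have hn := isStarNormal_invAddI hA
  rw [functionalCalculus_eq]
  conv_rhs => rw [← cfc_id ℂ (invAddI A)]
  refine cfc_congr fun z hz => ?_
  by_cases h0 : z = 0
  · simp [h0, circleFun_zero]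
  · have := eq_inv_of_mem (spectrum_invAddI_subset hA hz) h0
    rw [this, circleFun_inv]
    rfl

lemma mem_closedSpectralSubspace {K : Set ℝ} {x : H} :
    x ∈ closedSpectralSubspace A K ↔
      ∀ f : C₀(ℝ, ℂ), (∀ s ∈ K, f s = 0) → functionalCalculus A f x = 0 := by
  simp [closedSpectralSubspace]

lemma isClosed_closedSpectralSubspace (K : Set ℝ) :
    IsClosed (closedSpectralSubspace A K : Set H) := by
  simp only [closedSpectralSubspace, Submodule.coe_iInf]
  exact isClosed_iInter fun f => isClosed_iInter fun _ => (functionalCalculus A f).isClosed_ker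

lemma closedSpectralSubspace_mono {K L : Set ℝ} (h : K ⊆ L) :
    closedSpectralSubspace A K ≤ closedSpectralSubspace A L := fun _ hx =>
  mem_closedSpectralSubspace.2 fun f hf =>
    mem_closedSpectralSubspace.1 hx f fun s hs => hf s (h hs)

lemma spectralSubspace_eq {K : Set ℝ} (hK : IsClosed K) :
    spectralSubspace A K = closedSpectralSubspace A K := by
  have : (⨆ (L : Set ℝ) (_ : IsClosed L ∧ L ⊆ K), closedSpectralSubspace A L) =
      closedSpectralSubspace A K :=
    le_antisymm (iSup₂_le fun L hL => closedSpectralSubspace_mono hL.2)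
      (le_iSup₂_of_le K ⟨hK, subset_rfl⟩ le_rfl)
  rw [spectralSubspace, this]
  exact (isClosed_closedSpectralSubspace K).submodule_topologicalClosure_eq

lemma mem_spectralSubspace {K : Set ℝ} (hK : IsClosed K) {x : H} :
    x ∈ spectralSubspace A K ↔
      ∀ f : C₀(ℝ, ℂ), (∀ s ∈ K, f s = 0) → functionalCalculus A f x = 0 := by
  rw [spectralSubspace_eq hK, mem_closedSpectralSubspace]

/-- The constant `1` is not in `C₀(ℝ)`, so `1 - f` is multiplied by `(s + i)⁻¹`. The product
vanishes on `K`, and the injective operator `(A + i)⁻¹` is then cancelled. -/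
lemma functionalCalculus_apply_of_mem (hA : IsSelfAdjoint A) {K : Set ℝ} {x : H}
    (hx : x ∈ closedSpectralSubspace A K) {f : C₀(ℝ, ℂ)} (hf : ∀ s ∈ K, f s = 1) :
    functionalCalculus A f x = x := by
  have h := mem_closedSpectralSubspace.1 hx (invAddIFun - invAddIFun * f)
    fun s hs => by simp [hf s hs]
  rw [functionalCalculus_sub hA, functionalCalculus_mul hA, functionalCalculus_invAddIFun hA] at h
  refine (invAddI_injective hA ?_).symm
  exact sub_eq_zero.1 h

lemma functionalCalculus_mem (hA : IsSelfAdjoint A) {K : Set ℝ} {f : C₀(ℝ, ℂ)}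
    (hf : ∀ s, s ∉ K → f s = 0) (x : H) : functionalCalculus A f x ∈ closedSpectralSubspace A K := by
  refine mem_closedSpectralSubspace.2 fun g hg => ?_
  have : g * f = 0 := by
    ext s
    by_cases hs : s ∈ K
    · simp [hg s hs]
    · simp [hf s hs]
  have h0 := functionalCalculus_smul hA 0 (g * f)
  rw [zero_smul, zero_smul, ← this, functionalCalculus_mul hA] at h0
  exact congrArg (fun T : H →L[ℂ] H => T x) h0

end Calculus

/-! ### Isolated zeros in the spectrum of a normal operator -/

section NormalOperators

variable {H : Type u} [NormedAddCommGroup H] [InnerProductSpace ℂ H] [CompleteSpace H]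

/-- `B - w` acts as `-w` on the range of `P` and as `B + P - w` on the range of `1 - P`. The inverse
is assembled from these two blocks. -/
lemma isUnit_sub_smul_of_isUnit {B P : H →L[ℂ] H} (hBP : B * P = 0) (hPB : P * B = 0)
    (hP : P * P = P) {w : ℂ} (hw : w ≠ 0) (h : IsUnit (B + P - w • 1)) :
    IsUnit (B - w • 1) := by
  obtain ⟨u, hu⟩ := h
  have hPu : Commute P (u : H →L[ℂ] H) := by
    rw [hu, commute_iff_eq]
    simp only [mul_sub, mul_add, sub_mul, add_mul, hBP, hPB, hP, mul_smul_comm, smul_mul_assoc,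
      mul_one, one_mul]
  have hPv : P * ((u⁻¹ : (H →L[ℂ] H)ˣ) : H →L[ℂ] H) = ((u⁻¹ : (H →L[ℂ] H)ˣ) : H →L[ℂ] H) * P :=
    hPu.units_inv_right
  set V : H →L[ℂ] H := ((u⁻¹ : (H →L[ℂ] H)ˣ) : H →L[ℂ] H) with hV
  have h1 : (u : H →L[ℂ] H) * V = 1 := u.mul_inv
  have h2 : V * (u : H →L[ℂ] H) = 1 := u.inv_mul
  have hBu : B - w • 1 = u - P := by rw [hu]; abel
  have huP : (u : H →L[ℂ] H) * P = (1 - w) • P := by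
    rw [hu]
    simp only [sub_mul, add_mul, hBP, hP, smul_mul_assoc, one_mul]
    module
  have hPu' : P * (u : H →L[ℂ] H) = (1 - w) • P := by rw [← huP]; exact hPu
  have hVP : V * P = P * V := hPv.symm
  have hPVP : P * (V * P) = P * V := by rw [hVP, ← mul_assoc, hP]
  refine isUnit_iff_exists.2 ⟨V * (1 - P) - w⁻¹ • P, ?_, ?_⟩
  · rw [hBu]
    have : ((u : H →L[ℂ] H) - P) * (V * (1 - P) - w⁻¹ • P) =
        u * V - u * V * P - w⁻¹ • (u * P) - P * V + P * (V * P) + w⁻¹ • (P * P) := by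
      simp only [mul_sub, sub_mul, mul_one, mul_smul_comm, mul_assoc, smul_sub]
      abel
    rw [this, h1, huP, hPVP, hP, one_mul]
    match_scalars <;> field_simp <;> ring
  · rw [hBu]
    have : (V * (1 - P) - w⁻¹ • P) * ((u : H →L[ℂ] H) - P) =
        V * u - V * (P * u) - w⁻¹ • (P * u) - V * P + V * (P * P) + w⁻¹ • (P * P) := by
      simp only [mul_sub, sub_mul, mul_one, smul_mul_assoc, mul_assoc]
      abel
    rw [this, h2, hPu', hP, mul_smul_comm]
    have hVP2 : (1 - w) • (V * P) = P := by
      rw [← mul_smul_comm, ← huP, ← mul_assoc, h2, one_mul]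
    rw [hVP2]
    match_scalars <;> field_simp <;> ring

/-- If a bounded normal operator has closed range and finite-dimensional kernel, then `0` is at most
an isolated point of its spectrum. -/
lemma eventually_isUnit_sub_smul {B : H →L[ℂ] H} (hB : IsStarNormal B)
    [FiniteDimensional ℂ B.ker] (hr : IsClosed (B.range : Set H)) :
    ∀ᶠ w in 𝓝 (0 : ℂ), w ≠ 0 → IsUnit (B - w • 1) := by
  set P := B.ker.starProjection with hPdef
  have hBP : B * P = 0 := by
    ext x
    exact Submodule.starProjection_apply_mem B.ker x
  have hP : P * P = P := B.ker.isIdempotentElem_starProjection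
  -- Normality gives `(range B)ᗮ = ker B`; closedness of the range then allows taking complements.
  have hort : B.range = B.kerᗮ := by
    rw [← ContinuousLinearMap.IsStarNormal.orthogonal_range hB, Submodule.orthogonal_orthogonal_eq_closure]
    exact hr.submodule_topologicalClosure_eq.symm
  have hPB : P * B = 0 := by
    ext x
    have : B x ∈ B.kerᗮ := hort ▸ LinearMap.mem_range_self _ x
    exact (Submodule.starProjection_apply_eq_zero_iff _).2 this
  have hunit : IsUnit (B + P) := by
    rw [ContinuousLinearMap.isUnit_iff_bijective]
    constructor
    · rw [injective_iff_map_eq_zero]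
      intro x hx
      have h1 : P ((B + P) x) = P x := by
        have : P * (B + P) = P := by rw [mul_add, hPB, hP, zero_add]
        exact congrArg (fun T : H →L[ℂ] H => T x) this
      rw [hx, map_zero] at h1
      have h2 : B x = 0 := by
        rw [add_apply, ← h1, add_zero] at hx
        exact hx
      have h3 : P x = x := Submodule.starProjection_eq_self_iff.2 h2
      rw [← h3, ← h1]
    · intro y
      have : y - P y ∈ B.range := by
        rw [hort]
        exact Submodule.sub_starProjection_mem_orthogonal y
      obtain ⟨z, hz⟩ := this
      refine ⟨z - P z + P y, ?_⟩
      have e1 : ∀ t, B (P t) = 0 := fun t => congrArg (fun T : H →L[ℂ] H => T t) hBP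
      have e2 : ∀ t, P (P t) = P t := fun t => congrArg (fun T : H →L[ℂ] H => T t) hP
      have hz' : B z = y - P y := hz
      simp [e1, e2, hz']
  have hc : ContinuousAt (fun w : ℂ => B + P - w • (1 : H →L[ℂ] H)) 0 := by fun_prop
  have h0 : {T : H →L[ℂ] H | IsUnit T} ∈ 𝓝 (B + P - (0 : ℂ) • (1 : H →L[ℂ] H)) := by
    rw [zero_smul, sub_zero]
    exact Units.isOpen.mem_nhds hunit
  filter_upwards [hc h0] with w hw hw0
  exact isUnit_sub_smul_of_isUnit hBP hPB hP hw0 hw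

end NormalOperators

/-! ### The spectral gap of a self-adjoint Fredholm operator, and cutoffs -/

section Fredholm

variable {H : Type u} [NormedAddCommGroup H] [InnerProductSpace ℂ H] [CompleteSpace H]
  {A : H →ₗ.[ℂ] H}

/-- The kernel of an unbounded operator, as a subspace of the ambient space. -/
def kernel (A : H →ₗ.[ℂ] H) : Submodule ℂ H := (LinearMap.ker A.toFun).map A.domain.subtype

lemma mem_kernel {x : H} : x ∈ kernel A ↔ (x, 0) ∈ A.graph := by
  simp only [kernel, Submodule.mem_map, LinearMap.mem_ker, LinearPMap.mem_graph_iff]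
  constructor
  · rintro ⟨y, hy, rfl⟩
    exact ⟨y, rfl, hy⟩
  · rintro ⟨y, hy, hy'⟩
    exact ⟨y, hy', hy⟩

lemma ker_one_sub_invAddI (hA : IsSelfAdjoint A) :
    (1 - Complex.I • invAddI A : H →L[ℂ] H).ker ≤ kernel A := by
  intro x hx
  have h1 : x = Complex.I • invAddI A x := sub_eq_zero.1 hx
  have h2 := A.graph.smul_mem Complex.I ((isResolvent_invAddI hA).1 x)
  rw [mem_kernel]
  convert! h2 using 1
  rw [← h1, sub_self, Prod.smul_mk, ← h1, smul_zero]

/-- With `R = (A + i)⁻¹`, one has `1 - i R = A R`, and `R` maps onto the domain of `A`. -/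
lemma range_one_sub_invAddI (hA : IsSelfAdjoint A) :
    (1 - Complex.I • invAddI A : H →L[ℂ] H).range = LinearMap.range A.toFun := by
  apply le_antisymm
  · rintro _ ⟨x, rfl⟩
    obtain ⟨y, -, hy⟩ := (LinearPMap.mem_graph_iff A).1 ((isResolvent_invAddI hA).1 x)
    exact ⟨y, hy⟩
  · rintro _ ⟨x, rfl⟩
    refine ⟨A x + Complex.I • (x : H), ?_⟩
    have := (isResolvent_invAddI hA).2 x
    simp [this]

/-- `A` has no spectrum at the points `s` with `a ≤ |s| ≤ b`. -/
def SpectralGap (A : H →ₗ.[ℂ] H) (a b : ℝ) : Prop :=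
  ∀ s : ℝ, a ≤ |s| → |s| ≤ b → ((s : ℂ) + Complex.I)⁻¹ ∉ spectrum ℂ (invAddI A)

/-- The bounded normal operator `B = A (A + i)⁻¹` has closed range and finite-dimensional kernel, so
its spectrum has no points near `0` except possibly `0`. The point `s` corresponds to `w = s / (s +
i)` in the spectrum of `B`, and `w` vanishes only for `s = 0`. -/
lemma exists_spectralGap (hA : IsSelfAdjoint A) (hF : IsFredholm A) :
    ∃ ε > 0, ∀ s : ℝ, s ≠ 0 → |s| < ε → ((s : ℂ) + Complex.I)⁻¹ ∉ spectrum ℂ (invAddI A) := by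
  have := hF.finite_ker
  have hfd : FiniteDimensional ℂ (kernel A) := by unfold kernel; infer_instance
  set B : H →L[ℂ] H := 1 - Complex.I • invAddI A with hBdef
  have hn := isStarNormal_invAddI hA
  have hB : IsStarNormal B := by
    constructor
    have h1 : Commute (star (invAddI A)) (invAddI A) := hn.star_comm_self
    have h2 : Commute (star Complex.I • star (invAddI A)) (Complex.I • invAddI A) :=
      (h1.smul_left (star Complex.I)).smul_right Complex.I
    rw [hBdef, star_sub, star_one, star_smul]
    exact (Commute.one_left _).sub_left ((Commute.one_right _).sub_right h2)
  have hk : FiniteDimensional ℂ B.ker := Submodule.finiteDimensional_of_le (ker_one_sub_invAddI hA)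
  have hr : IsClosed (B.range : Set H) := by
    rw [range_one_sub_invAddI hA]
    exact hF.isClosed_range
  have key := eventually_isUnit_sub_smul hB hr
  have hcont : ContinuousAt
      (fun s : ℝ => -Complex.I * (((s : ℂ) + Complex.I)⁻¹ + Complex.I)) 0 := by
    have : ((0 : ℝ) : ℂ) + Complex.I ≠ 0 := ofReal_add_I_ne_zero 0
    fun_prop (disch := assumption)
  have h0 : -Complex.I * ((((0 : ℝ) : ℂ) + Complex.I)⁻¹ + Complex.I) = 0 := by simp
  rw [ContinuousAt, h0] at hcont
  obtain ⟨ε, hε, hball⟩ := Metric.eventually_nhds_iff.1 (hcont.eventually key)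
  refine ⟨ε, hε, fun s hs hsε => ?_⟩
  have hw : -Complex.I * (((s : ℂ) + Complex.I)⁻¹ + Complex.I) ≠ 0 := by
    have h1 := ofReal_add_I_ne_zero s
    intro h2
    have h3 : (s : ℂ) = 0 := by
      field_simp at h2
      linear_combination h2 + ((s : ℂ) + Complex.I) * Complex.I_sq
    simp [hs] at h3
  have hu := hball (by simpa using hsε) hw
  rw [spectrum.notMem_iff]
  have : algebraMap ℂ (H →L[ℂ] H) ((s : ℂ) + Complex.I)⁻¹ - invAddI A =
      (-Complex.I) • (B - (-Complex.I * (((s : ℂ) + Complex.I)⁻¹ + Complex.I)) • 1) := by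
    rw [hBdef, Algebra.algebraMap_eq_smul_one]
    match_scalars <;> ring_nf <;> simp
  rw [this]
  exact hu.smul (Units.mk0 (-Complex.I) (by simp))

/-- Cut-off functions `f` and `g` witnessing a gap at `±c` in the spectrum of `A`. -/
structure IsCutoff (A : H →ₗ.[ℂ] H) (c : ℝ) (f g : C₀(ℝ, ℂ)) : Prop where
  eq_zero : ∀ s, c ≤ |s| → f s = 0
  eq_one : ∀ s, |s| ≤ c → g s = 1
  star_eq : star f = f
  eq : functionalCalculus A f = functionalCalculus A g

/-- `f` descends from `1` to `0` on `a ≤ |s| ≤ c` and `g` on `c ≤ |s| ≤ b`; they differ only inside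
the gap. The pair is chosen before `A`, so one pair serves a whole neighbourhood of operators. -/
lemma exists_cutoff {a c b : ℝ} (hac : a < c) (hcb : c < b) :
    ∃ f g : C₀(ℝ, ℂ), ∀ (A : H →ₗ.[ℂ] H), IsSelfAdjoint A → SpectralGap A a b →
      IsCutoff A c f g := by
  have hF : ∀ u v : ℝ, Continuous fun s : ℝ => max 0 (min 1 ((v - |s|) / (v - u))) := by
    intro u v
    fun_prop
  obtain ⟨f, hf⟩ := exists_zeroAtInfty (hF a c) c fun s hs =>
    max_eq_left ((min_le_right _ _).trans (div_nonpos_of_nonpos_of_nonneg (by linarith)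
      (by linarith)))
  obtain ⟨g, hg⟩ := exists_zeroAtInfty (hF c b) b fun s hs =>
    max_eq_left ((min_le_right _ _).trans (div_nonpos_of_nonpos_of_nonneg (by linarith)
      (by linarith)))
  have h0 : ∀ u v s : ℝ, u < v → v ≤ |s| → max 0 (min 1 ((v - |s|) / (v - u))) = 0 :=
    fun u v s huv hs => max_eq_left ((min_le_right _ _).trans
      (div_nonpos_of_nonpos_of_nonneg (by linarith) (by linarith)))
  have h1 : ∀ u v s : ℝ, u < v → |s| ≤ u → max 0 (min 1 ((v - |s|) / (v - u))) = 1 := by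
    intro u v s huv hs
    rw [min_eq_left, max_eq_right zero_le_one]
    rw [le_div_iff₀ (by linarith)]
    linarith
  refine ⟨f, g, fun A hA hgap => ⟨fun s hs => ?_, fun s hs => ?_, ?_, ?_⟩⟩
  · rw [hf, h0 a c s hac hs, Complex.ofReal_zero]
  · rw [hg, h1 c b s hcb hs, Complex.ofReal_one]
  · ext s
    simp [hf]
  · refine functionalCalculus_congr hA fun s hs => ?_
    rw [hf, hg]
    rcases lt_or_ge |s| a with h | h
    · rw [h1 a c s hac h.le, h1 c b s hcb (h.le.trans hac.le)]
    · rcases le_or_gt |s| b with h' | h'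
      · exact absurd hs (hgap s h h')
      · rw [h0 a c s hac (hcb.le.trans h'.le), h0 c b s hcb h'.le]

lemma IsCutoff.apply_of_mem {c : ℝ} {f g : C₀(ℝ, ℂ)} (h : IsCutoff A c f g)
    (hA : IsSelfAdjoint A) {x : H} (hx : x ∈ spectralSubspace A (Set.Icc (-c) c)) :
    functionalCalculus A f x = x := by
  rw [spectralSubspace_eq isClosed_Icc] at hx
  rw [h.eq]
  exact functionalCalculus_apply_of_mem hA hx fun s hs => h.eq_one s (abs_le.2 hs)

lemma IsCutoff.mem {c : ℝ} {f g : C₀(ℝ, ℂ)} (h : IsCutoff A c f g)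
    (hA : IsSelfAdjoint A) (x : H) :
    functionalCalculus A f x ∈ spectralSubspace A (Set.Icc (-c) c) := by
  rw [spectralSubspace_eq isClosed_Icc]
  refine functionalCalculus_mem hA (fun s hs => h.eq_zero s ?_) x
  by_contra hlt
  exact hs (abs_le.1 (not_le.1 hlt).le)

/-- `f` vanishes off `[-c,c]`, so `f(A)` maps into the spectral subspace; `g` is `1` on `[-c,c]` and
`g(A) = f(A)`, so `f(A)` fixes that subspace. As `f` is real, the projection is orthogonal. -/
lemma IsCutoff.spectralProjection_eq {c : ℝ} {f g : C₀(ℝ, ℂ)} (h : IsCutoff A c f g)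
    (hA : IsSelfAdjoint A) :
    spectralProjection A (Set.Icc (-c) c) = functionalCalculus A f := by
  ext x
  refine Submodule.eq_starProjection_of_mem_of_inner_eq_zero (h.mem hA x) fun w hw => ?_
  have hs : IsSelfAdjoint (functionalCalculus A f) := by
    rw [IsSelfAdjoint, ← functionalCalculus_star, h.star_eq]
  have := (ContinuousLinearMap.isSelfAdjoint_iff_isSymmetric.1 hs) x w
  rw [ContinuousLinearMap.coe_coe, h.apply_of_mem hA hw] at this
  rw [inner_sub_left, this, sub_self]

lemma spectralSubspace_le_zero (hA : IsSelfAdjoint A) {ε : ℝ}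
    (hgap : ∀ s : ℝ, s ≠ 0 → |s| < ε → ((s : ℂ) + Complex.I)⁻¹ ∉ spectrum ℂ (invAddI A))
    {c : ℝ} (hcε : c < ε) :
    spectralSubspace A (Set.Icc (-c) c) ≤ spectralSubspace A {0} := by
  intro x hx
  rw [spectralSubspace_eq isClosed_Icc] at hx
  obtain ⟨f, hf⟩ := exists_zeroAtInfty
    (F := fun s : ℝ => max 0 (min 1 ((ε - |s|) / (ε - c)))) (by fun_prop) ε fun s hs =>
    max_eq_left ((min_le_right _ _).trans (div_nonpos_of_nonpos_of_nonneg (by linarith)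
      (by linarith)))
  have hfx : functionalCalculus A f x = x := by
    refine functionalCalculus_apply_of_mem hA hx fun s hs => ?_
    have hs' := abs_le.2 hs
    rw [hf, min_eq_left, max_eq_right zero_le_one, Complex.ofReal_one]
    rw [le_div_iff₀ (by linarith)]
    linarith
  refine (mem_spectralSubspace isClosed_singleton).2 fun k hk => ?_
  have h1 : functionalCalculus A (k * f) = functionalCalculus A ((0 : ℂ) • f) := by
    refine functionalCalculus_congr hA fun s hs => ?_
    by_cases h0 : s = 0
    · simp [h0, hk 0 rfl]
    · have hsε : ε ≤ |s| := by
        by_contra hlt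
        exact hgap s h0 (not_le.1 hlt) hs
      have : f s = 0 := by
        rw [hf, max_eq_left ((min_le_right _ _).trans
          (div_nonpos_of_nonpos_of_nonneg (by linarith) (by linarith))), Complex.ofReal_zero]
      simp [this]
  rw [functionalCalculus_smul hA, functionalCalculus_mul hA, zero_smul] at h1
  have h2 : functionalCalculus A k (functionalCalculus A f x) = 0 :=
    congrArg (fun T : H →L[ℂ] H => T x) h1
  rwa [hfx] at h2

/-- With `r(s) = (s + i)⁻¹`, the function `r - i r² = r (1 - i r)` vanishes at `0`. So `R (1 - i R)
x = 0` for `R = (A + i)⁻¹`, and `R` is injective. -/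
lemma spectralSubspace_zero_le_kernel (hA : IsSelfAdjoint A) :
    spectralSubspace A {0} ≤ kernel A := by
  intro x hx
  have h := (mem_spectralSubspace isClosed_singleton).1 hx
    (invAddIFun - Complex.I • (invAddIFun * invAddIFun)) fun s hs => by
      rw [Set.mem_singleton_iff.1 hs]
      simp
  rw [functionalCalculus_sub hA, functionalCalculus_smul hA, functionalCalculus_mul hA,
    functionalCalculus_invAddIFun hA] at h
  refine ker_one_sub_invAddI hA (invAddI_injective hA ?_)
  rw [map_zero, ← h]
  simp

end Fredholm

/-! ### Traces on invariant subspaces and conjugacy of nearby idempotents -/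

section Trace

variable {H : Type u} [NormedAddCommGroup H] [InnerProductSpace ℂ H]
  {K : Type v} [NormedAddCommGroup K] [InnerProductSpace ℂ K]

lemma traceOn_of_invariant {T : H →ₗ[ℂ] H} {E : Submodule ℂ H} (h : ∀ x ∈ E, T x ∈ E) :
    traceOn T E = LinearMap.trace ℂ E (T.restrict h) := dif_pos h

lemma traceOn_eq_of_equiv {V : Type*} [AddCommGroup V] [Module ℂ V] {S : V →ₗ[ℂ] V}
    {T : H →ₗ[ℂ] H} {E : Submodule ℂ H} (e : V ≃ₗ[ℂ] E) (h : ∀ v, (e (S v) : H) = T (e v)) :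
    traceOn T E = LinearMap.trace ℂ V S := by
  have hT : ∀ x ∈ E, T x ∈ E := fun x hx => by
    have := h (e.symm ⟨x, hx⟩)
    rw [e.apply_symm_apply] at this
    rw [← this]
    exact Subtype.prop _
  rw [traceOn_of_invariant hT, ← LinearMap.trace_conj' S e]
  congr 1
  ext x
  rw [LinearEquiv.conj_apply_apply, h, e.apply_symm_apply]
  rfl

/-- Stated with an abstract isomorphism so as to cover both internal sums of subspaces and subspaces
of `H ⊕ K`. -/
lemma traceOn_prod {T : H →ₗ[ℂ] H} {S : K →ₗ[ℂ] K} {E : Submodule ℂ H} {F : Submodule ℂ K}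
    {L : Type*} [NormedAddCommGroup L] [InnerProductSpace ℂ L] {W : L →ₗ[ℂ] L}
    {G : Submodule ℂ L} [FiniteDimensional ℂ E] [FiniteDimensional ℂ F]
    (hE : ∀ x ∈ E, T x ∈ E) (hF : ∀ x ∈ F, S x ∈ F) (e : (E × F) ≃ₗ[ℂ] G)
    (h : ∀ (x : E) (y : F), (e (⟨T x, hE x x.2⟩, ⟨S y, hF y y.2⟩) : L) = W (e (x, y))) :
    traceOn W G = traceOn T E + traceOn S F := by
  rw [traceOn_of_invariant hE, traceOn_of_invariant hF, ← LinearMap.trace_prodMap']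
  exact traceOn_eq_of_equiv e fun v => h v.1 v.2

lemma traceOn_sup {T : H →ₗ[ℂ] H} {E F : Submodule ℂ H} [FiniteDimensional ℂ E]
    [FiniteDimensional ℂ F] (hE : ∀ x ∈ E, T x ∈ E) (hF : ∀ x ∈ F, T x ∈ F) (hd : Disjoint E F) :
    traceOn T (E ⊔ F) = traceOn T E + traceOn T F := by
  have hinj : Function.Injective (E.subtype.coprod F.subtype) := by
    rw [← LinearMap.ker_eq_bot, LinearMap.ker_coprod_of_disjoint_range, Submodule.ker_subtype,
      Submodule.ker_subtype, Submodule.prod_bot]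
    rwa [Submodule.range_subtype, Submodule.range_subtype]
  have hr : LinearMap.range (E.subtype.coprod F.subtype) = E ⊔ F := by
    rw [LinearMap.range_coprod, Submodule.range_subtype, Submodule.range_subtype]
  refine traceOn_prod hE hF ((LinearEquiv.ofInjective _ hinj).trans (LinearEquiv.ofEq _ _ hr)) ?_
  intro x y
  change T x + T y = T (x + y)
  rw [map_add]

lemma traceOn_map {T : H →ₗ[ℂ] H} {E : Submodule ℂ H} (e : H ≃ₗ[ℂ] H)
    (he : ∀ y, e (T y) = T (e y)) (hE : ∀ x ∈ E, T x ∈ E) :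
    traceOn T (E.map (e : H →ₗ[ℂ] H)) = traceOn T E := by
  rw [traceOn_of_invariant hE]
  exact traceOn_eq_of_equiv (e.submoduleMap E) fun v => he v

/-- Two idempotents close to each other are conjugate. -/
lemma eventually_exists_equiv [CompleteSpace H] {X : Type*} [TopologicalSpace X]
    {D : X → H →L[ℂ] H} {x₀ : X} (hD : ContinuousAt D x₀)
    (hid : ∀ᶠ x in 𝓝 x₀, D x * D x = D x) {G : H →L[ℂ] H}
    (hG : ∀ᶠ x in 𝓝 x₀, Commute (D x) G) :
    ∀ᶠ x in 𝓝 x₀, ∃ e : H ≃ₗ[ℂ] H, (∀ y, e (G y) = G (e y)) ∧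
      (D x₀).range.map (e : H →ₗ[ℂ] H) = (D x).range := by
  have h0 := hid.self_of_nhds
  have hG0 := hG.self_of_nhds
  -- The operator `U = D D₀ + (1 - D)(1 - D₀)` equals `1` at `x₀`, hence is invertible nearby. It
  -- satisfies `U D₀ = D U` and commutes with whatever commutes with all the `D x`.
  have hc : ContinuousAt (fun x => D x * D x₀ + (1 - D x) * (1 - D x₀)) x₀ := by fun_prop
  have hU : {T : H →L[ℂ] H | IsUnit T} ∈ 𝓝 (D x₀ * D x₀ + (1 - D x₀) * (1 - D x₀)) := by
    have : D x₀ * D x₀ + (1 - D x₀) * (1 - D x₀) = 1 := by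
      simp only [mul_sub, sub_mul, mul_one, one_mul, h0]
      abel
    rw [this]
    exact Units.isOpen.mem_nhds isUnit_one
  filter_upwards [hc hU, hid, hG] with x hx hidx hGx
  set U := D x * D x₀ + (1 - D x) * (1 - D x₀) with hUdef
  have hb : Function.Bijective U := ContinuousLinearMap.isUnit_iff_bijective.1 hx
  have hcomm : U * D x₀ = D x * U := by
    simp only [hUdef, mul_sub, sub_mul, mul_add, add_mul, mul_one, one_mul, mul_assoc, h0]
    simp only [← mul_assoc, hidx]
    abel
  have hUG : Commute U G :=
    (hGx.mul_left hG0).add_left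
      (((Commute.one_left G).sub_left hGx).mul_left ((Commute.one_left G).sub_left hG0))
  refine ⟨LinearEquiv.ofBijective (U : H →ₗ[ℂ] H) hb,
    fun y => congrArg (fun T : H →L[ℂ] H => T y) hUG.eq, ?_⟩
  have h1 : ∀ y, U (D x₀ y) = D x (U y) := fun y =>
    congrArg (fun T : H →L[ℂ] H => T y) hcomm
  apply le_antisymm
  · rintro _ ⟨_, ⟨y, rfl⟩, rfl⟩
    exact ⟨U y, (h1 y).symm⟩
  · rintro _ ⟨z, rfl⟩
    obtain ⟨y, rfl⟩ := hb.2 z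
    exact ⟨D x₀ y, ⟨y, rfl⟩, h1 y⟩

lemma sub_starProjection_idempotent {U V : Submodule ℂ H} [U.HasOrthogonalProjection]
    [V.HasOrthogonalProjection] (h : U ≤ V) :
    (V.starProjection - U.starProjection) * (V.starProjection - U.starProjection) =
      V.starProjection - U.starProjection := by
  have h1 : V.starProjection * U.starProjection = U.starProjection := by
    ext x
    exact Submodule.starProjection_eq_self_iff.2 (h (Submodule.starProjection_apply_mem _ _))
  have h2 : U.starProjection * V.starProjection = U.starProjection :=
    Submodule.starProjection_comp_starProjection_of_le h
  have h3 : V.starProjection * V.starProjection = V.starProjection :=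
    V.isIdempotentElem_starProjection
  have h4 : U.starProjection * U.starProjection = U.starProjection :=
    U.isIdempotentElem_starProjection
  simp only [mul_sub, sub_mul, h1, h2, h3, h4]
  abel

end Trace

/-! ### Equivariance of the functional calculus and spectral subspaces under `γ` -/

section Intertwining

variable {H : Type u} [NormedAddCommGroup H] [InnerProductSpace ℂ H] [CompleteSpace H]
  {L : Type v} [NormedAddCommGroup L] [InnerProductSpace ℂ L] [CompleteSpace L]

/-- A bounded operator which maps the graph of `A` to that of `B` intertwines their functional
calculi. -/
lemma map_functionalCalculus {A : H →ₗ.[ℂ] H} {B : L →ₗ.[ℂ] L} (hA : IsSelfAdjoint A)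
    (hB : IsSelfAdjoint B) {V : H →L[ℂ] L} (hV : ∀ z ∈ A.graph, (V z.1, V z.2) ∈ B.graph)
    (f : C₀(ℝ, ℂ)) (x : H) : V (functionalCalculus A f x) = functionalCalculus B f (V x) := by
  have key : ∀ x, resolventS B (V x) = V (resolventS A x) ∧
      resolventT B (V x) = V (resolventT A x) := fun x => by
    refine eq_of_mem_graph hB (hV _ (mem_graph_S hA x)) ?_
    rw [← map_sub]
    exact hV _ (mem_graph_T hA x)
  have h1 : V ∘L invAddI A = invAddI B ∘L V := by
    ext x
    simp [invAddI_eq hA, invAddI_eq hB, key]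
  have h2 : V ∘L star (invAddI A) = star (invAddI B) ∘L V := by
    ext x
    simp [star_invAddI hA, star_invAddI hB, key]
  rw [functionalCalculus_eq, functionalCalculus_eq]
  exact congrArg (fun T : H →L[ℂ] L => T x) (comp_cfc_eq (isStarNormal_invAddI hA)
    (isStarNormal_invAddI hB) isCompact_resolventCircle (spectrum_invAddI_subset hA)
    (spectrum_invAddI_subset hB) h1 h2 (continuousOn_circleFun f))

end Intertwining

section Commutes

variable {H : Type u} [NormedAddCommGroup H] [InnerProductSpace ℂ H] [CompleteSpace H]
  {A : H →ₗ.[ℂ] H} {γ : H ≃ₗᵢ[ℂ] H}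

lemma Commutes.mem_graph (h : Commutes γ A) {z : H × H} (hz : z ∈ A.graph) :
    (γ z.1, γ z.2) ∈ A.graph := by
  obtain ⟨y, hy, hy'⟩ := (LinearPMap.mem_graph_iff A).1 hz
  rw [LinearPMap.mem_graph_iff]
  have h1 : γ y ∈ A.domain := (h.mem_domain_iff _).2 y.2
  refine ⟨⟨γ y, h1⟩, by simp [hy], ?_⟩
  rw [h.map_apply y y.2 h1, ← hy']

lemma functionalCalculus_map (hA : IsSelfAdjoint A) (h : Commutes γ A) (f : C₀(ℝ, ℂ)) (x : H) :
    functionalCalculus A f (γ x) = γ (functionalCalculus A f x) :=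
  (map_functionalCalculus hA hA (V := (γ : H →L[ℂ] H)) (fun _ hz => h.mem_graph hz) f x).symm

lemma map_mem_closedSpectralSubspace_iff (hA : IsSelfAdjoint A) (h : Commutes γ A) {K : Set ℝ}
    {x : H} : γ x ∈ closedSpectralSubspace A K ↔ x ∈ closedSpectralSubspace A K := by
  simp [mem_closedSpectralSubspace, functionalCalculus_map hA h]

lemma map_mem_spectralSubspace (hA : IsSelfAdjoint A) (h : Commutes γ A) {K : Set ℝ} :
    ∀ x ∈ spectralSubspace A K, γ.toLinearMap x ∈ spectralSubspace A K := by
  change spectralSubspace A K ≤ (spectralSubspace A K).comap γ.toLinearMap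
  refine Submodule.topologicalClosure_minimal _ ?_
    ((Submodule.isClosed_topologicalClosure _).preimage γ.continuous)
  refine iSup₂_le fun L hL x hx => Submodule.le_topologicalClosure _ ?_
  exact (le_iSup₂ (f := fun L (_ : IsClosed L ∧ L ⊆ K) => closedSpectralSubspace A L) L hL)
    ((map_mem_closedSpectralSubspace_iff hA h).2 hx)

lemma commute_spectralProjection (hA : IsSelfAdjoint A) (h : Commutes γ A) {K : Set ℝ}
    (hK : IsClosed K) : Commute (spectralProjection A K) (γ : H →L[ℂ] H) := by
  ext x
  refine Submodule.eq_starProjection_of_mem_of_inner_eq_zero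
    (map_mem_spectralSubspace hA h _ (Submodule.starProjection_apply_mem _ _)) fun w hw => ?_
  -- Invariance under `γ⁻¹` as well makes `γ` preserve the orthogonal complement.
  have hw' : γ.symm w ∈ spectralSubspace A K := by
    rw [spectralSubspace_eq hK] at hw ⊢
    rw [← map_mem_closedSpectralSubspace_iff hA h]
    simpa using hw
  have := Submodule.starProjection_inner_eq_zero (K := spectralSubspace A K) x _ hw'
  rw [← γ.inner_map_map, γ.apply_symm_apply, map_sub] at this
  exact this

/-- The trace of `γ` on the spectral subspace of `A` for `[0, c]`. -/
def spectralTrace (γ : H ≃ₗᵢ[ℂ] H) (A : H →ₗ.[ℂ] H) (c : ℝ) : ℂ :=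
  traceOn γ.toLinearMap (spectralSubspace A (Set.Icc 0 c))

lemma spectralSubspace_mono {K L : Set ℝ} (h : K ⊆ L) :
    spectralSubspace A K ≤ spectralSubspace A L :=
  Submodule.topologicalClosure_mono (iSup₂_le fun M hM =>
    le_iSup₂_of_le M ⟨hM.1, hM.2.trans h⟩ le_rfl)

end Commutes

/-! ### Continuity in gap-continuous families -/

section Families

variable {H : Type u} [NormedAddCommGroup H] [InnerProductSpace ℂ H] [CompleteSpace H]
  {γ : H ≃ₗᵢ[ℂ] H} {X : Type*} [TopologicalSpace X] {A : X → H →ₗ.[ℂ] H}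

lemma gapContinuous_iff :
    GapContinuous A ↔ Continuous fun x => (closedGraph (A x)).starProjection := by
  rw [continuous_iff_continuousAt]
  exact forall_congr' fun x => tendsto_iff_norm_sub_tendsto_zero.symm

lemma IsFredholmFamily.comp {Y : Type*} [TopologicalSpace Y] (hA : IsFredholmFamily γ A) {φ : Y → X}
    (hφ : Continuous φ) : IsFredholmFamily γ fun y => A (φ y) where
  selfAdjoint _ := hA.selfAdjoint _
  fredholm _ := hA.fredholm _
  commutes _ := hA.commutes _
  gapContinuous := gapContinuous_iff.2 ((gapContinuous_iff.1 hA.gapContinuous).comp hφ)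

namespace IsFredholmFamily

variable (hA : IsFredholmFamily γ A)
include hA

lemma continuous_invAddI : Continuous fun x => invAddI (A x) := by
  have h := gapContinuous_iff.1 hA.gapContinuous
  have h1 : (fun x => invAddI (A x)) =
      fun x => resolventT (A x) - Complex.I • resolventS (A x) :=
    funext fun x => invAddI_eq (hA.selfAdjoint x)
  rw [h1]
  have hS : Continuous fun x => resolventS (A x) :=
    continuous_const.clm_comp (h.clm_comp continuous_const)
  have hT : Continuous fun x => resolventT (A x) :=
    continuous_const.clm_comp (h.clm_comp continuous_const)
  fun_prop

/-- All the resolvents have spectrum in one compact circle on which the transported `f` is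
continuous, so norm continuity of the resolvents suffices. -/
lemma continuous_functionalCalculus (f : C₀(ℝ, ℂ)) :
    Continuous fun x => functionalCalculus (A x) f := by
  simp only [functionalCalculus_eq]
  refine hA.continuous_invAddI.cfc (s := fun _ => resolventCircle) _
    (fun _ => isCompact_resolventCircle)
    (fun _ => Eventually.of_forall fun x => spectrum_invAddI_subset (hA.selfAdjoint x))
    (fun _ => continuousOn_circleFun f) fun x => isStarNormal_invAddI (hA.selfAdjoint x)

/-- The part of the circle given by `a ≤ |s| ≤ b` is compact, and the spectrum is upper
hemicontinuous. -/
lemma eventually_spectralGap {x₀ : X} {a b : ℝ} (h : SpectralGap (A x₀) a b) :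
    ∀ᶠ x in 𝓝 x₀, SpectralGap (A x) a b := by
  have hK : IsCompact ((fun s : ℝ => ((s : ℂ) + Complex.I)⁻¹) ''
      ({s | a ≤ |s|} ∩ Set.Icc (-b) b)) := by
    refine (isCompact_Icc.inter_left (isClosed_le continuous_const continuous_abs)).image ?_
    exact Continuous.inv₀ (by fun_prop) ofReal_add_I_ne_zero
  have hu := (upperHemicontinuous_spectrum ℂ (H →L[ℂ] H)) (invAddI (A x₀))
  have hs : ((fun s : ℝ => ((s : ℂ) + Complex.I)⁻¹) ''
      ({s | a ≤ |s|} ∩ Set.Icc (-b) b))ᶜ ∈ 𝓝ˢ (spectrum ℂ (invAddI (A x₀))) := by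
    rw [hK.isClosed.isOpen_compl.mem_nhdsSet]
    rintro _ hz ⟨s, hs, rfl⟩
    exact h s hs.1 (abs_le.2 hs.2) hz
  have h2 := hA.continuous_invAddI.continuousAt.eventually (hu _ hs)
  filter_upwards [h2] with x hx s hsa hsb hz
  exact subset_of_mem_nhdsSet hx hz ⟨s, ⟨hsa, abs_le.1 hsb⟩, rfl⟩

lemma exists_eventually_isCutoff {x₀ : X} {a c b : ℝ} (hac : a < c) (hcb : c < b)
    (h : SpectralGap (A x₀) a b) :
    ∃ f g : C₀(ℝ, ℂ), ∀ᶠ x in 𝓝 x₀, IsCutoff (A x) c f g := by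
  obtain ⟨f, g, hfg⟩ := exists_cutoff (H := H) hac hcb
  exact ⟨f, g, (hA.eventually_spectralGap h).mono fun x hx => hfg _ (hA.selfAdjoint x) hx⟩

lemma continuousAt_spectralProjection {x₀ : X} {c : ℝ} {f g : C₀(ℝ, ℂ)}
    (h : ∀ᶠ x in 𝓝 x₀, IsCutoff (A x) c f g) :
    ContinuousAt (fun x => spectralProjection (A x) (Set.Icc (-c) c)) x₀ :=
  (hA.continuous_functionalCalculus f).continuousAt.congr
    (h.mono fun x hx => (hx.spectralProjection_eq (hA.selfAdjoint x)).symm)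

lemma eventually_finiteDimensional {x₀ : X} {K : Set ℝ}
    [FiniteDimensional ℂ (spectralSubspace (A x₀) K)]
    (hc : ContinuousAt (fun x => spectralProjection (A x) K) x₀) :
    ∀ᶠ x in 𝓝 x₀, FiniteDimensional ℂ (spectralSubspace (A x) K) := by
  have := eventually_exists_equiv hc
    (Eventually.of_forall fun x => (spectralSubspace (A x) K).isIdempotentElem_starProjection)
    (G := 1) (Eventually.of_forall fun x => Commute.one_right _)
  filter_upwards [this] with x hx
  obtain ⟨e, -, he⟩ := hx
  simp only [spectralProjection, Submodule.range_starProjection] at he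
  rw [← he]
  infer_instance

end IsFredholmFamily

end Families

/-! ### Local constancy of differences of spectral traces -/

section LocalConstancy

variable {H : Type u} [NormedAddCommGroup H] [InnerProductSpace ℂ H] [CompleteSpace H]
  {γ : H ≃ₗᵢ[ℂ] H} {X : Type*} [TopologicalSpace X]

lemma exists_ramp {c a : ℝ} (hc : 0 < c) :
    ∃ φ : C₀(ℝ, ℂ), (∀ s, s ≤ -c → φ s = 0) ∧ ∀ s, c ≤ s → s ≤ a → φ s = 1 := by
  obtain ⟨φ, hφ⟩ := exists_zeroAtInfty
    (F := fun s : ℝ => max 0 (min 1 ((s + c) / (2 * c))) * max 0 (min 1 (a + 1 - |s|)))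
    (by fun_prop) (a + 1) fun s hs => by
      rw [max_eq_left (a := (0 : ℝ)) (b := min 1 (a + 1 - |s|)), mul_zero]
      exact (min_le_right _ _).trans (by linarith)
  refine ⟨φ, fun s hs => ?_, fun s hs hsa => ?_⟩
  · rw [hφ, max_eq_left, zero_mul, Complex.ofReal_zero]
    exact (min_le_right _ _).trans (div_nonpos_of_nonpos_of_nonneg (by linarith) (by linarith))
  · have h1 : (1 : ℝ) ≤ (s + c) / (2 * c) := by
      rw [le_div_iff₀ (by linarith)]
      linarith
    have h2 : (1 : ℝ) ≤ a + 1 - |s| := by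
      rw [abs_of_pos (by linarith)]
      linarith
    rw [hφ, min_eq_left h1, min_eq_left h2, max_eq_right zero_le_one, mul_one, Complex.ofReal_one]

/-- The product of `(φ - φ g)(A)` with the spectral projection for `[-a, a]`, where `φ` is a ramp
around `0` and `g` a cutoff at `±c`, is a (not a priori orthogonal) projection which complements the
spectral subspace for `[0, c]` inside the spectral subspace for `[0, a]`. -/
lemma spectralTrace_eq_add {A : H →ₗ.[ℂ] H} (hA : IsSelfAdjoint A) (hγ : Commutes γ A)
    {a c : ℝ} (hc : 0 < c) (hca : c < a) {f g φ : C₀(ℝ, ℂ)} (hfg : IsCutoff A c f g)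
    (hφ0 : ∀ s, s ≤ -c → φ s = 0) (hφ1 : ∀ s, c ≤ s → s ≤ a → φ s = 1)
    (hfin : FiniteDimensional ℂ (spectralSubspace A (Set.Icc (-a) a))) {D : H →L[ℂ] H}
    (hD : D = functionalCalculus A (φ - φ * g) * spectralProjection A (Set.Icc (-a) a)) :
    D * D = D ∧ Commute D (γ : H →L[ℂ] H) ∧
      spectralTrace γ A a = spectralTrace γ A c + traceOn γ.toLinearMap D.range ∧
      ∀ x ∈ D.range, γ.toLinearMap x ∈ D.range := by
  have hPmem : ∀ x, spectralProjection A (Set.Icc (-a) a) x ∈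
      spectralSubspace A (Set.Icc (-a) a) := fun x => Submodule.starProjection_apply_mem _ _
  have hPeq : ∀ x ∈ spectralSubspace A (Set.Icc (-a) a),
      spectralProjection A (Set.Icc (-a) a) x = x := fun x hx =>
    Submodule.starProjection_eq_self_iff.2 hx
  have hle : spectralSubspace A (Set.Icc 0 a) ≤ spectralSubspace A (Set.Icc (-a) a) :=
    spectralSubspace_mono (Set.Icc_subset_Icc_left (by linarith))
  have hlec : spectralSubspace A (Set.Icc 0 c) ≤ spectralSubspace A (Set.Icc 0 a) :=
    spectralSubspace_mono (Set.Icc_subset_Icc_right hca.le)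
  have hle' : spectralSubspace A (Set.Icc 0 c) ≤ spectralSubspace A (Set.Icc (-c) c) :=
    spectralSubspace_mono (Set.Icc_subset_Icc_left (by linarith))
  have hg : ∀ s, |s| ≤ c → φ s - φ s * g s = 0 := fun s hs => by
    rw [hfg.eq_one s hs]
    ring
  -- Replacing `g` by `f` leaves the operator unchanged but moves the transition inside `|s| ≤ c`.
  -- With one factor of each kind, the products below vanish at every point of the interval
  -- concerned, without reference to the spectrum.
  have hψ : functionalCalculus A (φ - φ * g) = functionalCalculus A (φ - φ * f) := by
    rw [functionalCalculus_sub hA, functionalCalculus_sub hA, functionalCalculus_mul hA,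
      functionalCalculus_mul hA, hfg.eq]
  have hDapply : ∀ x, D x = functionalCalculus A (φ - φ * g)
      (spectralProjection A (Set.Icc (-a) a) x) := fun x => by rw [hD]; rfl
  have hmaps : ∀ x ∈ spectralSubspace A (Set.Icc (-a) a),
      functionalCalculus A (φ - φ * g) x ∈ spectralSubspace A (Set.Icc 0 a) := by
    intro x hx
    refine (mem_spectralSubspace isClosed_Icc).2 fun k hk => ?_
    have := (mem_spectralSubspace isClosed_Icc).1 hx (k * (φ - φ * g)) fun s hs => by
      simp only [ZeroAtInftyContinuousMap.mul_apply, ZeroAtInftyContinuousMap.sub_apply]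
      rcases le_or_gt |s| c with h | h
      · rw [hg s h, mul_zero]
      · rcases le_total 0 s with h0 | h0
        · rw [hk s ⟨h0, hs.2⟩, zero_mul]
        · rw [hφ0 s (by rw [abs_of_nonpos h0] at h; linarith)]
          ring
    rw [functionalCalculus_mul hA] at this
    exact this
  have hDD : D * D = D := by
    ext x
    change D (D x) = D x
    rw [hDapply (D x), hDapply x, hPeq _ (hle (hmaps _ (hPmem x)))]
    -- For `|s| ≤ c` the factor `φ - φ g` is `0`; for `c < |s|` within `[-a,a]`, `f` is `0` and `φ`
    -- is `0` or `1`.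
    have := (mem_spectralSubspace isClosed_Icc).1 (hPmem x)
      ((φ - φ * f) * (φ - φ * g) - (φ - φ * g)) fun s hs => by
      simp only [ZeroAtInftyContinuousMap.mul_apply, ZeroAtInftyContinuousMap.sub_apply]
      rcases le_or_gt |s| c with h | h
      · rw [hg s h]
        ring
      · rw [hfg.eq_zero s h.le]
        rcases le_total 0 s with h0 | h0
        · rw [hφ1 s (by rw [abs_of_nonneg h0] at h; linarith) hs.2]
          ring
        · rw [hφ0 s (by rw [abs_of_nonpos h0] at h; linarith)]
          ring
    rw [functionalCalculus_sub hA, functionalCalculus_mul hA, ← hψ] at this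
    exact sub_eq_zero.1 this
  have hDγ : Commute D (γ : H →L[ℂ] H) := by
    rw [hD]
    refine Commute.mul_left ?_ (commute_spectralProjection hA hγ isClosed_Icc)
    ext x
    exact functionalCalculus_map hA hγ _ x
  have hrinv : ∀ x ∈ D.range, γ.toLinearMap x ∈ D.range := by
    rintro _ ⟨y, rfl⟩
    exact ⟨γ y, congrArg (fun T : H →L[ℂ] H => T y) hDγ.eq⟩
  have hr : D.range ≤ spectralSubspace A (Set.Icc 0 a) := by
    rintro _ ⟨y, rfl⟩
    change D y ∈ _
    rw [hDapply]
    exact hmaps _ (hPmem y)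
  have hsup : spectralSubspace A (Set.Icc 0 a) = spectralSubspace A (Set.Icc 0 c) ⊔ D.range := by
    refine le_antisymm (fun x hx => ?_) (sup_le hlec hr)
    -- On `[0,a]` the function `φ - φ g + g` is `1`. Since `g(A) = f(A)`, this splits `x` into `D x`
    -- and `f(A) x`, the latter lying in `E_[0,c]`.
    have h1 : functionalCalculus A ((φ - φ * g) + g) x = x := by
      rw [spectralSubspace_eq isClosed_Icc] at hx
      refine functionalCalculus_apply_of_mem hA hx fun s hs => ?_
      simp only [ZeroAtInftyContinuousMap.mul_apply, ZeroAtInftyContinuousMap.sub_apply,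
        ZeroAtInftyContinuousMap.add_apply]
      rcases le_or_gt |s| c with h | h
      · rw [hg s h, hfg.eq_one s h, zero_add]
      · rw [hφ1 s (by rw [abs_of_nonneg hs.1] at h; exact h.le) hs.2]
        ring
    have h2 : functionalCalculus A ((φ - φ * g) + g) = functionalCalculus A (φ - φ * g) +
        functionalCalculus A f := by
      have := functionalCalculus_sub hA ((φ - φ * g) + g) g
      rw [add_sub_cancel_right] at this
      rw [this, hfg.eq]
      abel
    rw [h2, add_apply] at h1
    rw [← h1, add_comm]
    refine Submodule.add_mem_sup ?_ ⟨x, ?_⟩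
    · refine (mem_spectralSubspace isClosed_Icc).2 fun k hk => ?_
      have := (mem_spectralSubspace isClosed_Icc).1 hx (k * f) fun s hs => by
        rw [ZeroAtInftyContinuousMap.mul_apply]
        rcases le_or_gt c |s| with h | h
        · rw [hfg.eq_zero s h, mul_zero]
        · rw [hk s ⟨hs.1, by rw [abs_of_nonneg hs.1] at h; exact h.le⟩, zero_mul]
      rw [functionalCalculus_mul hA] at this
      exact this
    · change D x = _
      rw [hDapply, hPeq x (hle hx)]
  have hdisj : Disjoint (spectralSubspace A (Set.Icc 0 c)) D.range := by
    rw [Submodule.disjoint_def]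
    rintro x hx ⟨z, rfl⟩
    change D z = 0
    have h1 : functionalCalculus A f (D z) = D z := hfg.apply_of_mem hA (hle' hx)
    rw [← h1, hDapply]
    have := (mem_spectralSubspace isClosed_Icc).1 (hPmem z) (f * (φ - φ * g)) fun s hs => by
      simp only [ZeroAtInftyContinuousMap.mul_apply, ZeroAtInftyContinuousMap.sub_apply]
      rcases le_or_gt c |s| with h | h
      · rw [hfg.eq_zero s h, zero_mul]
      · rw [hg s h.le, mul_zero]
    rw [functionalCalculus_mul hA] at this
    exact this
  refine ⟨hDD, hDγ, ?_, hrinv⟩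
  have f1 : FiniteDimensional ℂ (spectralSubspace A (Set.Icc 0 a)) :=
    Submodule.finiteDimensional_of_le hle
  have f2 : FiniteDimensional ℂ (spectralSubspace A (Set.Icc 0 c)) :=
    Submodule.finiteDimensional_of_le hlec
  have f3 : FiniteDimensional ℂ D.range := Submodule.finiteDimensional_of_le hr
  rw [spectralTrace, hsup]
  exact traceOn_sup (map_mem_spectralSubspace hA hγ) hrinv hdisj

variable {A : X → H →ₗ.[ℂ] H}

/-- Up to a locally constant function, the trace of `γ` on the spectral subspace for `[0, a]` does
not depend on `a`. -/
lemma IsFredholmFamily.eventually_spectralTrace_sub (hA : IsFredholmFamily γ A) {a : ℝ}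
    (ha : 0 ≤ a) {x₀ : X} (hfin : FiniteDimensional ℂ (spectralSubspace (A x₀) (Set.Icc (-a) a)))
    (hcont : ContinuousAt (fun x => spectralProjection (A x) (Set.Icc (-a) a)) x₀) :
    ∀ᶠ c in 𝓝[>] (0 : ℝ), ∀ᶠ x in 𝓝 x₀, spectralTrace γ (A x) a - spectralTrace γ (A x) c =
      spectralTrace γ (A x₀) a - spectralTrace γ (A x₀) c := by
  obtain ⟨ε, hε, hgap⟩ := exists_spectralGap (hA.selfAdjoint x₀) (hA.fredholm x₀)
  have hcut : ∀ c, 0 < c → c < ε → ∃ f g : C₀(ℝ, ℂ), ∀ᶠ x in 𝓝 x₀, IsCutoff (A x) c f g :=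
    fun c hc hcε => hA.exists_eventually_isCutoff (a := c / 2) (b := (c + ε) / 2) (by linarith)
      (by linarith) fun s hs hs' => hgap s (fun h => by
        rw [h, abs_zero] at hs
        linarith) (by linarith)
  rcases ha.eq_or_lt with rfl | ha
  -- For `a = 0` the hypothesis is continuity of `P_{0}`. The idempotents `P_[-c,c] - P_{0}` are
  -- continuous at `x₀` and vanish there by the gap, hence vanish nearby: no eigenvalue leaves `0`
  -- within `[-c,c]`.
  · filter_upwards [Ioo_mem_nhdsGT hε] with c hc
    obtain ⟨f, g, hfg⟩ := hcut c hc.1 hc.2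
    have hPc := hA.continuousAt_spectralProjection hfg
    have hle : ∀ x, spectralSubspace (A x) (Set.Icc (-0) 0) ≤
        spectralSubspace (A x) (Set.Icc (-c) c) := fun x =>
      spectralSubspace_mono (Set.Icc_subset_Icc (by linarith [hc.1]) hc.1.le)
    have h0 : spectralSubspace (A x₀) (Set.Icc (-c) c) =
        spectralSubspace (A x₀) (Set.Icc (-0) 0) := by
      refine le_antisymm ?_ (hle x₀)
      have := spectralSubspace_le_zero (hA.selfAdjoint x₀) hgap hc.2
      simpa using this
    have key := eventually_exists_equiv (hPc.sub hcont)
      (Eventually.of_forall fun x => sub_starProjection_idempotent (hle x)) (G := 1)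
      (Eventually.of_forall fun x => Commute.one_right _)
    have heq : ∀ x, spectralSubspace (A x) (Set.Icc (-c) c) =
        spectralSubspace (A x) (Set.Icc (-0) 0) →
        spectralTrace γ (A x) 0 = spectralTrace γ (A x) c := by
      intro x hx
      rw [spectralTrace, spectralTrace]
      congr 1
      refine le_antisymm (spectralSubspace_mono (Set.Icc_subset_Icc_right hc.1.le)) ?_
      refine (spectralSubspace_mono (Set.Icc_subset_Icc_left (by linarith [hc.1]))).trans
        (hx.le.trans ?_)
      rw [neg_zero]
    filter_upwards [key] with x hx
    obtain ⟨e, -, he⟩ := hx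
    simp only [Pi.sub_apply] at he
    rw [heq x₀ h0, sub_self, heq x, sub_self]
    have hzero : spectralProjection (A x₀) (Set.Icc (-c) c) -
        spectralProjection (A x₀) (Set.Icc (-0) 0) = 0 := by
      simp only [spectralProjection, h0, sub_self]
    have hbot : (spectralProjection (A x) (Set.Icc (-c) c) -
        spectralProjection (A x) (Set.Icc (-0) 0)).range = ⊥ := by
      rw [← he, hzero]
      simp
    have hproj : spectralProjection (A x) (Set.Icc (-c) c) =
        spectralProjection (A x) (Set.Icc (-0) 0) := by
      rw [← sub_eq_zero]
      ext y
      have : (spectralProjection (A x) (Set.Icc (-c) c) -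
        spectralProjection (A x) (Set.Icc (-0) 0)) y ∈ (⊥ : Submodule ℂ H) := hbot ▸ ⟨y, rfl⟩
      exact this
    exact Submodule.starProjection_inj.1 hproj
  -- For `a > 0` there may be spectrum at `±a`, so no continuous cutoff need produce `P_[-a,a]`. Its
  -- assumed continuity enters through the factor of `D`.
  · filter_upwards [Ioo_mem_nhdsGT (lt_min hε ha)] with c hc
    obtain ⟨hc0, hcm⟩ := hc
    obtain ⟨hcε, hca⟩ := lt_min_iff.1 hcm
    obtain ⟨f, g, hfg⟩ := hcut c hc0 hcε
    obtain ⟨φ, hφ0, hφ1⟩ := exists_ramp (a := a) hc0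
    have hfin' := hA.eventually_finiteDimensional hcont
    have hprop : ∀ᶠ x in 𝓝 x₀, _ := (hfg.and hfin').mono fun x hx =>
      spectralTrace_eq_add (hA.selfAdjoint x) (hA.commutes x) hc0 hca hx.1 hφ0 hφ1 hx.2 rfl
    have hDc : ContinuousAt (fun x => functionalCalculus (A x) (φ - φ * g) *
        spectralProjection (A x) (Set.Icc (-a) a)) x₀ :=
      (hA.continuous_functionalCalculus _).continuousAt.mul hcont
    have key := eventually_exists_equiv hDc (hprop.mono fun x hx => hx.1)
      (hprop.mono fun x hx => hx.2.1)
    filter_upwards [key, hprop] with x hx hpx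
    obtain ⟨e, he, he'⟩ := hx
    rw [hpx.2.2.1, hprop.self_of_nhds.2.2.1, add_sub_cancel_left, add_sub_cancel_left, ← he']
    exact traceOn_map e he hprop.self_of_nhds.2.2.2

lemma IsFredholmFamily.exists_cutoff (hA : IsFredholmFamily γ A) (x₀ : X) :
    ∃ (a : ℝ) (f g : C₀(ℝ, ℂ)), 0 < a ∧
      FiniteDimensional ℂ (spectralSubspace (A x₀) (Set.Icc (-a) a)) ∧
      ∀ᶠ x in 𝓝 x₀, IsCutoff (A x) a f g := by
  obtain ⟨ε, hε, hgap⟩ := exists_spectralGap (hA.selfAdjoint x₀) (hA.fredholm x₀)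
  obtain ⟨f, g, hfg⟩ := hA.exists_eventually_isCutoff (x₀ := x₀) (a := ε / 4) (c := ε / 3)
    (b := ε / 2) (by linarith) (by linarith) fun s hs hs' => hgap s (fun h => by
      rw [h, abs_zero] at hs
      linarith) (by linarith)
  refine ⟨ε / 3, f, g, by linarith, ?_, hfg⟩
  have := (hA.fredholm x₀).finite_ker
  have : FiniteDimensional ℂ (kernel (A x₀)) := by unfold kernel; infer_instance
  exact Submodule.finiteDimensional_of_le
    ((spectralSubspace_le_zero (hA.selfAdjoint x₀) hgap (by linarith)).trans
      (spectralSubspace_zero_le_kernel (hA.selfAdjoint x₀)))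

/-- Around every point there is `a > 0` for which the spectral projections for `[-a, a]` are
continuous and of finite rank. -/
lemma IsFredholmFamily.exists_finite_continuousAt (hA : IsFredholmFamily γ A) (x₀ : X) :
    ∃ a > 0, ∀ᶠ x in 𝓝 x₀, FiniteDimensional ℂ (spectralSubspace (A x) (Set.Icc (-a) a)) ∧
      ContinuousAt (fun x => spectralProjection (A x) (Set.Icc (-a) a)) x := by
  obtain ⟨a, f, g, ha, hfin, hfg⟩ := hA.exists_cutoff x₀
  refine ⟨a, ha, (hA.eventually_finiteDimensional
    (hA.continuousAt_spectralProjection hfg)).and ?_⟩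
  exact (eventually_eventually_nhds.2 hfg).mono fun x hx => hA.continuousAt_spectralProjection hx

end LocalConstancy

/-! ### Flow potentials -/

section Potential

variable {H : Type u} [NormedAddCommGroup H] [InnerProductSpace ℂ H] [CompleteSpace H]
  {γ : H ≃ₗᵢ[ℂ] H} {X : Type*} [TopologicalSpace X]

/-- A function `Φ` on the parameter space whose local variation is that of the trace of `γ` on the
spectral subspaces for `[0, c]`, for all small `c > 0`. Its increments compute the spectral flow. -/
def IsFlowPotential (γ : H ≃ₗᵢ[ℂ] H) (A : X → H →ₗ.[ℂ] H) (Φ : X → ℂ) : Prop :=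
  ∀ x₀, ∀ᶠ c in 𝓝[>] (0 : ℝ), ∀ᶠ x in 𝓝 x₀,
    Φ x - spectralTrace γ (A x) c = Φ x₀ - spectralTrace γ (A x₀) c

variable {A : X → H →ₗ.[ℂ] H} {Φ Ψ : X → ℂ}

lemma eventually_sub_eq {x₀ : X}
    (h : ∀ᶠ c in 𝓝[>] (0 : ℝ), ∀ᶠ x in 𝓝 x₀,
      Φ x - spectralTrace γ (A x) c = Φ x₀ - spectralTrace γ (A x₀) c)
    (h' : ∀ᶠ c in 𝓝[>] (0 : ℝ), ∀ᶠ x in 𝓝 x₀,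
      Ψ x - spectralTrace γ (A x) c = Ψ x₀ - spectralTrace γ (A x₀) c) :
    ∀ᶠ x in 𝓝 x₀, Φ x - Ψ x = Φ x₀ - Ψ x₀ := by
  obtain ⟨c, hc, hc'⟩ := (h.and h').exists
  filter_upwards [hc, hc'] with x hx hx'
  linear_combination hx - hx'

lemma IsFlowPotential.sub_eq [PreconnectedSpace X] (h : IsFlowPotential γ A Φ)
    (h' : IsFlowPotential γ A Ψ) (x y : X) : Φ x - Φ y = Ψ x - Ψ y := by
  have hl : IsLocallyConstant fun x => Φ x - Ψ x :=
    (IsLocallyConstant.iff_eventually_eq _).2 fun x => eventually_sub_eq (h x) (h' x)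
  linear_combination hl.apply_eq_of_preconnectedSpace x y

/-- Glues potentials: if trace increments along `A` are sums of those along reparametrised pieces `B
i`, the potentials of the pieces add up to one for `A`. Partitions and concatenations both use it.
-/
lemma IsFlowPotential.sum {ι : Type*} [Fintype ι] {B : ι → X → H →ₗ.[ℂ] H} {Θ : ι → X → ℂ}
    (h : ∀ i, IsFlowPotential γ (B i) (Θ i))
    (hAB : ∀ c x y, spectralTrace γ (A x) c - spectralTrace γ (A y) c =
      ∑ i, (spectralTrace γ (B i x) c - spectralTrace γ (B i y) c)) :
    IsFlowPotential γ A fun x => ∑ i, Θ i x := by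
  intro x₀
  filter_upwards [eventually_all.2 fun i => h i x₀] with c hc
  filter_upwards [eventually_all.2 hc] with x hx
  have h1 : ∑ i, (Θ i x - Θ i x₀) =
      ∑ i, (spectralTrace γ (B i x) c - spectralTrace γ (B i x₀) c) :=
    Finset.sum_congr rfl fun i _ => by linear_combination hx i
  rw [← hAB, Finset.sum_sub_distrib] at h1
  linear_combination h1

lemma IsFredholmFamily.isFlowPotential_spectralTrace (hA : IsFredholmFamily γ A) {a : ℝ}
    (ha : 0 ≤ a) (hfin : ∀ x, FiniteDimensional ℂ (spectralSubspace (A x) (Set.Icc (-a) a)))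
    (hcont : Continuous fun x => spectralProjection (A x) (Set.Icc (-a) a)) :
    IsFlowPotential γ A fun x => spectralTrace γ (A x) a := fun x₀ =>
  hA.eventually_spectralTrace_sub ha (hfin x₀) hcont.continuousAt

end Potential

/-! ### Flow partitions: existence and the potential of a partition -/

section Partition

variable {H : Type u} [NormedAddCommGroup H] [InnerProductSpace ℂ H] [CompleteSpace H]
  {γ : H ≃ₗᵢ[ℂ] H} {A : unitInterval → H →ₗ.[ℂ] H} {Φ : unitInterval → ℂ}

/-- A telescoping sum: clamping `s` to an interval gives full increments to the left of `s`, zero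
increments to the right, and a partial one where `s` lies. -/
lemma sum_clamp {α : Type*} [LinearOrder α] (F : α → ℂ) (s : α) : ∀ (n : ℕ) (u : Fin (n + 1) → α),
    Monotone u → ∑ k : Fin n, (F (max (u k.castSucc) (min s (u k.succ))) - F (u k.castSucc)) =
      F (max (u 0) (min s (u (Fin.last n)))) - F (u 0) := by
  intro n
  induction n with
  | zero =>
    intro u _
    simp
  | succ n ih =>
    intro u hu
    have h1 := ih (fun k => u k.castSucc) (hu.comp Fin.strictMono_castSucc.monotone)
    rw [Fin.sum_univ_castSucc]
    simp only [Fin.castSucc_zero, ← Fin.succ_castSucc] at h1 ⊢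
    rw [h1, Fin.succ_last]
    have h2 : u 0 ≤ u (Fin.last n).castSucc := hu (Fin.zero_le _)
    have h3 : u (Fin.last n).castSucc ≤ u (Fin.last (n + 1)) := hu (Fin.le_last _)
    rcases le_total s (u (Fin.last n).castSucc) with h | h
    · rw [min_eq_left h, min_eq_left (h.trans h3), max_eq_left h]
      ring
    · rw [min_eq_right h, max_eq_right h2]
      rw [max_eq_right (le_min h h3), max_eq_right (h2.trans (le_min h h3))]
      ring

lemma FlowPartition.exists_isFlowPotential (hA : IsFredholmFamily γ A) (p : FlowPartition A) :
    ∃ Φ : unitInterval → ℂ, IsFlowPotential γ A Φ ∧ p.flow γ = Φ 1 - Φ 0 := by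
  have hle : ∀ k : Fin p.n, p.t k.castSucc ≤ p.t k.succ := fun k =>
    p.strictMono.monotone Fin.castSucc_lt_succ.le
  -- Precomposition with the clamp onto the `k`-th subinterval turns continuity on that subinterval
  -- into continuity on all of `[0,1]`, so the breakpoints need no one-sided analysis.
  set cl : Fin p.n → unitInterval → unitInterval := fun k s =>
    max (p.t k.castSucc) (min s (p.t k.succ)) with hcl
  have hcc : ∀ k, Continuous (cl k) := fun k => by simp only [hcl]; fun_prop
  have hmem : ∀ k s, cl k s ∈ Set.Icc (p.t k.castSucc) (p.t k.succ) := fun k s =>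
    ⟨le_max_left _ _, max_le (hle k) (min_le_right _ _)⟩
  have hsum : ∀ (F : unitInterval → ℂ) (s : unitInterval),
      ∑ k, (F (cl k s) - F (p.t k.castSucc)) = F s - F 0 := fun F s => by
    rw [sum_clamp F s p.n p.t p.strictMono.monotone, p.t_zero, p.t_last,
      min_eq_left unitInterval.le_one', max_eq_right unitInterval.nonneg']
  have hpot : IsFlowPotential γ A fun s => ∑ k, spectralTrace γ (A (cl k s)) (p.a k) := by
    refine IsFlowPotential.sum (B := fun k s => A (cl k s)) (fun k => ?_) fun c s s' => ?_
    · exact (hA.comp (hcc k)).isFlowPotential_spectralTrace (p.a_nonneg k)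
        (fun s => p.finite k _ (hmem k s)) ((p.continuousOn k).comp_continuous (hcc k) (hmem k))
    · have h1 := hsum (fun s => spectralTrace γ (A s) c) s
      have h2 := hsum (fun s => spectralTrace γ (A s) c) s'
      rw [Finset.sum_sub_distrib] at h1 h2 ⊢
      linear_combination h2 - h1
  refine ⟨_, hpot, ?_⟩
  rw [← Finset.sum_sub_distrib]
  refine Finset.sum_congr rfl fun k _ => ?_
  have h1 : cl k 1 = p.t k.succ := by
    simp only [hcl]
    rw [min_eq_right unitInterval.le_one', max_eq_right (hle k)]
  have h0 : cl k 0 = p.t k.castSucc := by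
    simp only [hcl]
    rw [min_eq_left unitInterval.nonneg', max_eq_left unitInterval.nonneg']
  rw [h1, h0]
  rfl

lemma FlowPartition.flow_eq (hA : IsFredholmFamily γ A) (p : FlowPartition A)
    (hΦ : IsFlowPotential γ A Φ) : p.flow γ = Φ 1 - Φ 0 := by
  obtain ⟨Ψ, hΨ, hp⟩ := p.exists_isFlowPotential hA
  rw [hp, hΨ.sub_eq hΦ]

lemma IsFredholmFamily.nonempty_flowPartition (hA : IsFredholmFamily γ A) :
    Nonempty (FlowPartition A) := by
  have hloc := hA.exists_finite_continuousAt
  choose a ha hev using hloc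
  choose U hU hUo hxU using fun x => eventually_nhds_iff.1 (hev x)
  obtain ⟨δ, hδ, hball⟩ := lebesgue_number_lemma_of_metric (s := (Set.univ : Set unitInterval))
    isCompact_univ hUo fun x _ => Set.mem_iUnion.2 ⟨x, hxU x⟩
  obtain ⟨n, hn⟩ := exists_nat_one_div_lt hδ
  have hn0 : (0 : ℝ) < (n : ℝ) + 1 := by positivity
  have hmem : ∀ k : Fin (n + 1 + 1), ((k : ℕ) : ℝ) / ((n : ℝ) + 1) ∈ unitInterval := fun k => by
    refine ⟨by positivity, ?_⟩
    rw [div_le_one hn0]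
    exact_mod_cast Nat.lt_succ_iff.1 k.2
  set t : Fin (n + 1 + 1) → unitInterval := fun k => ⟨_, hmem k⟩ with ht
  -- The mesh `1 / (n + 1)` is below the Lebesgue number `δ`, so the `k`-th subinterval lies in the
  -- `δ`-ball about its left end, hence in a single `U (y k)`, whose level `a (y k)` is used.
  choose y hy using fun k : Fin (n + 1) => hball (t k.castSucc) trivial
  have hsub : ∀ k : Fin (n + 1), ∀ s ∈ Set.Icc (t k.castSucc) (t k.succ), s ∈ U (y k) := by
    intro k s hs
    refine hy k ?_
    have h1 : (((k : ℕ) : ℝ) / ((n : ℝ) + 1)) ≤ s := hs.1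
    have h2 : (s : ℝ) ≤ ((k : ℕ) + 1 : ℝ) / ((n : ℝ) + 1) := by
      have : (s : ℝ) ≤ ((k.succ : ℕ) : ℝ) / ((n : ℝ) + 1) := hs.2
      simpa using this
    rw [Metric.mem_ball, Subtype.dist_eq, Real.dist_eq]
    change |(s : ℝ) - ((k : ℕ) : ℝ) / ((n : ℝ) + 1)| < δ
    rw [abs_of_nonneg (by linarith)]
    rw [add_div] at h2
    linarith
  exact ⟨{
    n := n + 1
    t := t
    a := fun k => a (y k)
    strictMono := fun i j hij => by
      change ((i : ℕ) : ℝ) / ((n : ℝ) + 1) < ((j : ℕ) : ℝ) / ((n : ℝ) + 1)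
      gcongr
      exact hij
    t_zero := by
      apply Subtype.ext
      simp [ht]
    t_last := by
      apply Subtype.ext
      change (((Fin.last (n + 1) : Fin (n + 1 + 1)) : ℕ) : ℝ) / ((n : ℝ) + 1) = 1
      rw [div_eq_one_iff_eq hn0.ne', Fin.val_last]
      push_cast
      rfl
    a_nonneg := fun k => (ha (y k)).le
    finite := fun k s hs => (hU (y k) s (hsub k s hs)).1
    continuousOn := fun k s hs => (hU (y k) s (hsub k s hs)).2.continuousWithinAt }⟩

lemma IsFredholmFamily.exists_isFlowPotential (hA : IsFredholmFamily γ A) :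
    ∃ Φ : unitInterval → ℂ, IsFlowPotential γ A Φ := by
  obtain ⟨p⟩ := hA.nonempty_flowPartition
  obtain ⟨Φ, hΦ, -⟩ := p.exists_isFlowPotential hA
  exact ⟨Φ, hΦ⟩

lemma sf_eq_flow (hA : IsFredholmFamily γ A) :
    ∃ p : FlowPartition A, sf γ A = p.flow γ :=
  ⟨hA.nonempty_flowPartition.some, dif_pos hA.nonempty_flowPartition⟩

lemma IsFlowPotential.sf_eq (hA : IsFredholmFamily γ A) (hΦ : IsFlowPotential γ A Φ) :
    sf γ A = Φ 1 - Φ 0 := by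
  obtain ⟨p, hp⟩ := sf_eq_flow hA
  rw [hp, p.flow_eq hA hΦ]

end Partition

/-! ### Invertible families, concatenation and homotopy -/

section Properties

variable {H : Type u} [NormedAddCommGroup H] [InnerProductSpace ℂ H] [CompleteSpace H]
  {γ : H ≃ₗᵢ[ℂ] H}

lemma traceOn_bot (T : H →ₗ[ℂ] H) : traceOn T ⊥ = 0 := by
  have h : ∀ x ∈ (⊥ : Submodule ℂ H), T x ∈ (⊥ : Submodule ℂ H) := fun x hx => by
    rw [(Submodule.mem_bot ℂ).1 hx, map_zero]
    exact Submodule.zero_mem _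
  rw [traceOn_of_invariant h]
  have : T.restrict h = 0 := by
    ext x
  rw [this, map_zero]

/-- An invertible operator has a spectral gap at `0`, and so have the operators close to it. -/
lemma IsFredholmFamily.isFlowPotential_zero {X : Type*} [TopologicalSpace X]
    {A : X → H →ₗ.[ℂ] H} (hA : IsFredholmFamily γ A) (hinj : ∀ x, Function.Injective (A x)) :
    IsFlowPotential γ A fun _ => 0 := by
  intro x₀
  obtain ⟨ε, hε, hgap⟩ := exists_spectralGap (hA.selfAdjoint x₀) (hA.fredholm x₀)
  have hker : kernel (A x₀) = ⊥ := by
    rw [kernel, LinearMap.ker_eq_bot.2 (hinj x₀), Submodule.map_bot]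
  filter_upwards [Ioo_mem_nhdsGT hε] with c hc
  obtain ⟨f, g, hfg⟩ := hA.exists_eventually_isCutoff (x₀ := x₀) (a := c / 2) (c := c)
    (b := (c + ε) / 2) (by linarith [hc.1]) (by linarith [hc.2]) fun s hs hs' =>
      hgap s (fun h => by
        rw [h, abs_zero] at hs
        linarith [hc.1]) (by linarith [hc.2])
  have hbot : spectralSubspace (A x₀) (Set.Icc (-c) c) = ⊥ := by
    rw [eq_bot_iff, ← hker]
    exact (spectralSubspace_le_zero (hA.selfAdjoint x₀) hgap hc.2).trans
      (spectralSubspace_zero_le_kernel (hA.selfAdjoint x₀))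
  have key := eventually_exists_equiv (hA.continuousAt_spectralProjection hfg)
    (Eventually.of_forall fun x =>
      (spectralSubspace (A x) (Set.Icc (-c) c)).isIdempotentElem_starProjection)
    (G := 1) (Eventually.of_forall fun x => Commute.one_right _)
  have hzero : ∀ x, spectralSubspace (A x) (Set.Icc (-c) c) = ⊥ →
      spectralTrace γ (A x) c = 0 := fun x hx => by
    have : spectralSubspace (A x) (Set.Icc 0 c) = ⊥ := by
      rw [eq_bot_iff, ← hx]
      exact spectralSubspace_mono (Set.Icc_subset_Icc_left (by linarith [hc.1]))
    rw [spectralTrace, this, traceOn_bot]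
  filter_upwards [key] with x hx
  obtain ⟨e, -, he⟩ := hx
  simp only [spectralProjection, Submodule.range_starProjection, hbot, Submodule.map_bot] at he
  rw [hzero x he.symm, hzero x₀ hbot]

/-- At every time one of the two reparametrised paths rests at the junction `B 0`. So a quantity
attached to operators takes on the concatenation the sum of its values on both paths minus its value
at `B 0`. -/
lemma concat_eq {A B : unitInterval → H →ₗ.[ℂ] H} (hAB : A 1 = B 0) (t : unitInterval) :
    (concat A B t = A (Set.projIcc 0 1 zero_le_one (2 * (t : ℝ))) ∧
      B (Set.projIcc 0 1 zero_le_one (2 * (t : ℝ) - 1)) = B 0) ∨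
    (concat A B t = B (Set.projIcc 0 1 zero_le_one (2 * (t : ℝ) - 1)) ∧
      A (Set.projIcc 0 1 zero_le_one (2 * (t : ℝ))) = B 0) := by
  by_cases h : (t : ℝ) ≤ 1 / 2
  · left
    refine ⟨if_pos h, ?_⟩
    rw [Set.projIcc_of_le_left zero_le_one (by linarith)]
    rfl
  · right
    refine ⟨if_neg h, ?_⟩
    rw [Set.projIcc_of_right_le zero_le_one (by linarith), ← hAB]
    rfl

lemma IsFredholmFamily.concat {A B : unitInterval → H →ₗ.[ℂ] H} (hA : IsFredholmFamily γ A)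
    (hB : IsFredholmFamily γ B) (hAB : A 1 = B 0) : IsFredholmFamily γ (concat A B) where
  selfAdjoint t := by
    rcases concat_eq hAB t with h | h <;> rw [h.1]
    exacts [hA.selfAdjoint _, hB.selfAdjoint _]
  fredholm t := by
    rcases concat_eq hAB t with h | h <;> rw [h.1]
    exacts [hA.fredholm _, hB.fredholm _]
  commutes t := by
    rcases concat_eq hAB t with h | h <;> rw [h.1]
    exacts [hA.commutes _, hB.commutes _]
  gapContinuous := by
    rw [gapContinuous_iff]
    have h1 := (gapContinuous_iff.1 hA.gapContinuous).comp
      (f := fun t : unitInterval => Set.projIcc 0 1 zero_le_one (2 * (t : ℝ)))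
      (continuous_projIcc.comp (by fun_prop))
    have h2 := (gapContinuous_iff.1 hB.gapContinuous).comp
      (f := fun t : unitInterval => Set.projIcc 0 1 zero_le_one (2 * (t : ℝ) - 1))
      (continuous_projIcc.comp (by fun_prop))
    have h3 : (fun t => (closedGraph (SpectralFlow.concat A B t)).starProjection) =
        fun t : unitInterval =>
        (closedGraph (A (Set.projIcc 0 1 zero_le_one (2 * (t : ℝ))))).starProjection +
        (closedGraph (B (Set.projIcc 0 1 zero_le_one (2 * (t : ℝ) - 1)))).starProjection -
        (closedGraph (B 0)).starProjection := by
      funext t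
      rcases concat_eq hAB t with h | h <;> rw [h.1, h.2] <;> abel
    rw [h3]
    exact (h1.add h2).sub continuous_const

lemma sf_concat {A B : unitInterval → H →ₗ.[ℂ] H} (hA : IsFredholmFamily γ A)
    (hB : IsFredholmFamily γ B) (hAB : A 1 = B 0) :
    sf γ (concat A B) = sf γ A + sf γ B := by
  obtain ⟨Φ, hΦ⟩ := hA.exists_isFlowPotential
  obtain ⟨Ψ, hΨ⟩ := hB.exists_isFlowPotential
  have hc1 : Continuous fun t : unitInterval =>
      (Set.projIcc 0 1 zero_le_one (2 * (t : ℝ)) : unitInterval) :=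
    continuous_projIcc.comp (by fun_prop)
  have hc2 : Continuous fun t : unitInterval =>
      (Set.projIcc 0 1 zero_le_one (2 * (t : ℝ) - 1) : unitInterval) :=
    continuous_projIcc.comp (by fun_prop)
  have h := IsFlowPotential.sum (γ := γ) (A := concat A B) (ι := Bool)
    (B := fun i t => bif i then A (Set.projIcc 0 1 zero_le_one (2 * (t : ℝ)))
      else B (Set.projIcc 0 1 zero_le_one (2 * (t : ℝ) - 1)))
    (Θ := fun i t => bif i then Φ (Set.projIcc 0 1 zero_le_one (2 * (t : ℝ)))
      else Ψ (Set.projIcc 0 1 zero_le_one (2 * (t : ℝ) - 1)))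
    (by
      rintro (_ | _)
      · exact fun t => (hΨ _).mono fun c hc => hc2.continuousAt.eventually hc
      · exact fun t => (hΦ _).mono fun c hc => hc1.continuousAt.eventually hc) (by
      intro c s t
      rw [Fintype.sum_bool]
      simp only [cond_true, cond_false]
      rcases concat_eq hAB s with h | h <;> rcases concat_eq hAB t with h' | h' <;>
        rw [h.1, h.2, h'.1, h'.2] <;> ring)
  rw [h.sf_eq (hA.concat hB hAB), hΦ.sf_eq hA, hΨ.sf_eq hB, Fintype.sum_bool, Fintype.sum_bool]
  simp only [cond_true, cond_false]
  have e1 : (Set.projIcc 0 1 zero_le_one (2 * ((1 : unitInterval) : ℝ)) : unitInterval) = 1 :=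
    Set.projIcc_of_right_le _ (by norm_num)
  have e2 : (Set.projIcc 0 1 zero_le_one (2 * ((1 : unitInterval) : ℝ) - 1) : unitInterval) = 1 :=
    Set.projIcc_of_right_le _ (by norm_num)
  have e3 : (Set.projIcc 0 1 zero_le_one (2 * ((0 : unitInterval) : ℝ)) : unitInterval) = 0 :=
    Set.projIcc_of_le_left _ (by norm_num)
  have e4 : (Set.projIcc 0 1 zero_le_one (2 * ((0 : unitInterval) : ℝ) - 1) : unitInterval) = 0 :=
    Set.projIcc_of_le_left _ (by norm_num)
  rw [e1, e2, e3, e4]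
  ring

lemma isPreconnected_ball_unitInterval (t : unitInterval) (r : ℝ) :
    IsPreconnected (Metric.ball t r) := by
  apply Set.OrdConnected.isPreconnected
  refine Set.ordConnected_iff.2 fun x hx y hy _ z hz => ?_
  rw [Metric.mem_ball, Subtype.dist_eq, Real.dist_eq, abs_lt] at hx hy ⊢
  have h1 : (x : ℝ) ≤ z := hz.1
  have h2 : (z : ℝ) ≤ y := hz.2
  constructor <;> linarith

/-- The potentials of the rows, normalised to vanish at `t = 0`, are shown to be potentials in `s`
too. This holds on the edge `t = 0`, where everything is constant, and spreads along `t`; on the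
edge `t = 1` the traces do not depend on `s`, so the flow is locally constant in `s`. -/
lemma sf_homotopy {A : unitInterval × unitInterval → H →ₗ.[ℂ] H} (hA : IsFredholmFamily γ A)
    (h0 : ∀ s, A (0, s) = A (0, 0)) (h1 : ∀ s, A (1, s) = A (1, 0)) :
    sf γ (fun t => A (t, 1)) = sf γ (fun t => A (t, 0)) := by
  have hrow : ∀ s, IsFredholmFamily γ fun t => A (t, s) := fun s => hA.comp (by fun_prop)
  have hcol : ∀ t, IsFredholmFamily γ fun s => A (t, s) := fun t => hA.comp (by fun_prop)
  choose Φ hΦ using fun s => (hrow s).exists_isFlowPotential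
  set Θ : unitInterval → unitInterval → ℂ := fun t s => Φ s t - Φ s 0 with hΘ
  have hΘrow : ∀ s, IsFlowPotential γ (fun t => A (t, s)) fun t => Θ t s := by
    intro s t
    filter_upwards [hΦ s t] with c hc
    filter_upwards [hc] with t' ht'
    simp only [hΘ]
    linear_combination ht'
  have hsf : ∀ s, sf γ (fun t => A (t, s)) = Θ 1 s := fun s => by
    rw [(hΦ s).sf_eq (hrow s)]
  suffices hl : IsLocallyConstant (Θ 1) by
    rw [hsf, hsf]
    exact hl.apply_eq_of_preconnectedSpace 1 0
  refine (IsLocallyConstant.iff_eventually_eq _).2 fun s₀ => ?_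
  -- `W t` says that `Θ t` satisfies the potential condition at `s₀` for the column at `t`. It is
  -- shown to be locally constant as a `Prop`-valued function of `t`.
  set W : unitInterval → Prop := fun t => ∀ᶠ c in 𝓝[>] (0 : ℝ), ∀ᶠ s in 𝓝 s₀,
    Θ t s - spectralTrace γ (A (t, s)) c = Θ t s₀ - spectralTrace γ (A (t, s₀)) c with hW
  have hconst : ∀ t, (∀ s, A (t, s) = A (t, 0)) → ∀ c s,
      spectralTrace γ (A (t, s)) c = spectralTrace γ (A (t, s₀)) c := fun t ht c s => by
    rw [ht s, ht s₀]
  have hW0 : W 0 := Eventually.of_forall fun c => Eventually.of_forall fun s => by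
    rw [hconst 0 h0]
    simp [hΘ]
  have hloc : ∀ t₀, ∀ᶠ t in 𝓝 t₀, W t ↔ W t₀ := by
    intro t₀
    obtain ⟨a, ha, hev⟩ := hA.exists_finite_continuousAt (t₀, s₀)
    rw [nhds_prod_eq, eventually_prod_iff] at hev
    obtain ⟨pU, hU, pV, hV, hUV⟩ := hev
    obtain ⟨r, hr, hUsub⟩ := Metric.mem_nhds_iff.1 hU
    set U := Metric.ball t₀ r
    have hUt : t₀ ∈ U := Metric.mem_ball_self hr
    -- On the rectangle where `P_[-a,a]` is continuous and of finite rank, the trace at level `a` is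
    -- a local potential in both directions. Along a row it therefore differs from `Θ` by a constant
    -- on the connected interval `U`.
    have hslope : ∀ s, pV s → ∀ t ∈ U, Θ t s - spectralTrace γ (A (t, s)) a =
        Θ t₀ s - spectralTrace γ (A (t₀, s)) a := by
      intro s hs t ht
      have : PreconnectedSpace U := Subtype.preconnectedSpace (isPreconnected_ball_unitInterval t₀ r)
      have hl : IsLocallyConstant fun t : U => Θ t s - spectralTrace γ (A (t, s)) a := by
        refine (IsLocallyConstant.iff_eventually_eq _).2 fun t => ?_
        obtain ⟨hfin, hcont⟩ := hUV (hUsub t.2) hs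
        have hcont' : ContinuousAt (fun t' => spectralProjection (A (t', s)) (Set.Icc (-a) a))
            (t : unitInterval) :=
          ContinuousAt.comp (f := fun t' : unitInterval => (t', s)) hcont (by fun_prop)
        have := eventually_sub_eq (hΘrow s t)
          (((hrow s).eventually_spectralTrace_sub ha.le hfin hcont'))
        exact continuous_subtype_val.continuousAt.eventually this
      exact hl.apply_eq_of_preconnectedSpace ⟨t, ht⟩ ⟨t₀, hUt⟩
    -- The right-hand side involves only `t₀`, so `W t` has the same truth value for all `t` in `U`.
    have hchar : ∀ t ∈ U, (W t ↔ ∀ᶠ s in 𝓝 s₀,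
        Θ t₀ s - spectralTrace γ (A (t₀, s)) a = Θ t₀ s₀ - spectralTrace γ (A (t₀, s₀)) a) := by
      intro t ht
      obtain ⟨hfin, hcont⟩ := hUV (hUsub ht) hV.self_of_nhds
      have hcont' : ContinuousAt (fun s => spectralProjection (A (t, s)) (Set.Icc (-a) a)) s₀ :=
        ContinuousAt.comp (f := fun s : unitInterval => (t, s)) hcont (by fun_prop)
      have hcolt := (hcol t).eventually_spectralTrace_sub ha.le hfin hcont'
      constructor
      · intro hWt
        filter_upwards [eventually_sub_eq (A := fun s => A (t, s)) (Φ := fun s => Θ t s) hWt hcolt,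
          hV] with s hs hs'
        rw [← hslope s hs' t ht, ← hslope s₀ hV.self_of_nhds t ht]
        exact hs
      · intro h
        filter_upwards [hcolt] with c hc
        filter_upwards [hc, h, hV] with s hs hs' hsV
        rw [← hslope s hsV t ht, ← hslope s₀ hV.self_of_nhds t ht] at hs'
        linear_combination hs + hs'
    filter_upwards [Metric.ball_mem_nhds t₀ hr] with t ht
    rw [hchar t ht, hchar t₀ hUt]
  have hWl : IsLocallyConstant W :=
    (IsLocallyConstant.iff_eventually_eq _).2 fun t => (hloc t).mono fun _ h => propext h
  have hW1 : W 1 := (hWl.apply_eq_of_preconnectedSpace 0 1) ▸ hW0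
  obtain ⟨c, hc⟩ := hW1.exists
  filter_upwards [hc] with s hs
  rw [hconst 1 h1] at hs
  linear_combination hs

end Properties

/-! ### The finite-dimensional formula -/

section FiniteDimensional

variable {H : Type u} [NormedAddCommGroup H] [InnerProductSpace ℂ H] [CompleteSpace H]
  {γ : H ≃ₗᵢ[ℂ] H} [FiniteDimensional ℂ H]

/-- In finite dimension the injective `(A + i)⁻¹` is invertible, so `0`, which corresponds to `s =
∞`, has a neighbourhood free of its spectrum. -/
lemma exists_spectrum_bound {A : H →ₗ.[ℂ] H} (hA : IsSelfAdjoint A) :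
    ∃ L > 0, ∀ s : ℝ, ((s : ℂ) + Complex.I)⁻¹ ∈ spectrum ℂ (invAddI A) → |s| < L := by
  have h0 : (0 : ℂ) ∉ spectrum ℂ (invAddI A) := by
    rw [spectrum.zero_notMem_iff, ContinuousLinearMap.isUnit_iff_bijective]
    exact ⟨invAddI_injective hA,
      LinearMap.injective_iff_surjective (f := (invAddI A : H →ₗ[ℂ] H)).1 (invAddI_injective hA)⟩
  have hopen : (spectrum ℂ (invAddI A))ᶜ ∈ 𝓝 (0 : ℂ) :=
    (spectrum.isClosed (𝕜 := ℂ) (invAddI A)).isOpen_compl.mem_nhds h0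
  have ht := invAddIFun.zero_at_infty'
  have hev := ht.eventually hopen
  rw [← Metric.cobounded_eq_cocompact, ← comap_norm_atTop, eventually_comap,
    eventually_atTop] at hev
  obtain ⟨r, hr⟩ := hev
  refine ⟨|r| + 1, by positivity, fun s hs => ?_⟩
  by_contra hlt
  refine hr ‖s‖ ?_ s rfl hs
  rw [Real.norm_eq_abs]
  linarith [le_abs_self r, not_lt.1 hlt]

/-- The two subspaces are orthogonal complements: cutoffs near `0` separate `[0,L]` from closed sets
of negative numbers, and the gap of `A` at `0` separates `0` from the negative spectrum. -/
lemma isCompl_spectralSubspace {A : H →ₗ.[ℂ] H} (hA : IsSelfAdjoint A) (hF : IsFredholm A) {L : ℝ}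
    (hL : spectralSubspace A (Set.Icc (-L) L) = ⊤) :
    IsCompl (spectralSubspace A (Set.Iio 0)) (spectralSubspace A (Set.Icc 0 L)) := by
  obtain ⟨ε, hε, hgap⟩ := exists_spectralGap hA hF
  have hstar : ∀ (f : C₀(ℝ, ℂ)) (x y : H), ⟪functionalCalculus A f x, y⟫_ℂ =
      ⟪x, functionalCalculus A (star f) y⟫_ℂ := fun f x y => by
    rw [functionalCalculus_star, ContinuousLinearMap.star_eq_adjoint,
      ContinuousLinearMap.adjoint_inner_right]
  have key : spectralSubspace A (Set.Icc 0 L) = (spectralSubspace A (Set.Iio 0))ᗮ := by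
    apply le_antisymm
    · rw [Submodule.le_orthogonal_iff_le_orthogonal, spectralSubspace]
      refine Submodule.topologicalClosure_minimal _ ?_ (Submodule.isClosed_orthogonal _)
      refine iSup₂_le fun K hK x hx => (Submodule.mem_orthogonal' _ _).2 fun y hy => ?_
      obtain ⟨η, hη, hηK⟩ : ∃ η > 0, ∀ s ∈ K, s ≤ -η := by
        have : Kᶜ ∈ 𝓝 (0 : ℝ) := hK.1.isOpen_compl.mem_nhds fun h => lt_irrefl (0 : ℝ) (hK.2 h)
        obtain ⟨η, hη, hb⟩ := Metric.mem_nhds_iff.1 this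
        refine ⟨η, hη, fun s hs => ?_⟩
        by_contra hlt
        have hs0 : s < 0 := hK.2 hs
        refine hb ?_ hs
        rw [mem_ball_zero_iff, Real.norm_eq_abs, abs_of_neg hs0]
        linarith
      -- `θ` is `1` on `[0,L]` and `0` on `s ≤ -η`, so `θ(A)` fixes `y` and kills `x`.
      obtain ⟨θ, hθ⟩ := exists_zeroAtInfty
        (F := fun s : ℝ => max 0 (min 1 ((s + η) / η)) * max 0 (min 1 (L + 1 - |s|)))
        (by fun_prop) (L + 1) fun s hs => by
          rw [max_eq_left (a := (0 : ℝ)) (b := min 1 (L + 1 - |s|)), mul_zero]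
          exact (min_le_right _ _).trans (by linarith)
      have hy' : functionalCalculus A θ y = y := by
        rw [spectralSubspace_eq isClosed_Icc] at hy
        refine functionalCalculus_apply_of_mem hA hy fun s hs => ?_
        have h1 : (1 : ℝ) ≤ (s + η) / η := by
          rw [le_div_iff₀ hη]
          linarith [hs.1]
        have h2 : (1 : ℝ) ≤ L + 1 - |s| := by
          rw [abs_of_nonneg hs.1]
          linarith [hs.2]
        rw [hθ, min_eq_left h1, min_eq_left h2, max_eq_right zero_le_one, mul_one,
          Complex.ofReal_one]
      have hx' : functionalCalculus A θ x = 0 := mem_closedSpectralSubspace.1 hx θ fun s hs => by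
        rw [hθ, max_eq_left, zero_mul, Complex.ofReal_zero]
        refine (min_le_right _ _).trans (div_nonpos_of_nonpos_of_nonneg ?_ hη.le)
        linarith [hηK s hs]
      have hθs : star θ = θ := by
        ext s
        simp [hθ]
      rw [← hy', ← hθs, ← hstar, hx', inner_zero_left]
    · intro y hy
      refine (mem_spectralSubspace isClosed_Icc).2 fun k hk => ?_
      by_cases hL0 : L < 0
      · have : y ∈ (⊤ : Submodule ℂ H) := trivial
        rw [← hL, mem_spectralSubspace isClosed_Icc] at this
        exact this k fun s hs => absurd (hs.1.trans hs.2) (by linarith)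
      have hk0 : k 0 = 0 := hk 0 ⟨le_rfl, not_lt.1 hL0⟩
      have hnorm : Tendsto (fun s => ‖k s‖) (cocompact ℝ) (𝓝 0) := by
        simpa using! k.zero_at_infty'.norm
      -- On the spectrum `k = n + m`, with `n` the restriction of `k` to `s ≥ 0` extended by `0`
      -- (continuous, as `k 0 = 0`) and `m` the negative part. `n(A)` kills `y` because `n` vanishes
      -- on `[-L,L]`; `m(A)` does because `y` is orthogonal to the negative subspace.
      obtain ⟨n, hn⟩ : ∃ n : C₀(ℝ, ℂ), ∀ s, n s = k (max s 0) := ⟨⟨⟨fun s => k (max s 0), by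
        fun_prop⟩, by
        refine squeeze_zero_norm (fun s => ?_) hnorm
        change ‖k (max s 0)‖ ≤ ‖k s‖
        rcases le_total s 0 with h | h
        · rw [max_eq_right h, hk0, norm_zero]
          positivity
        · rw [max_eq_left h]⟩, fun _ => rfl⟩
      have hχ : ∀ s : ℝ, |max 0 (min 1 ((-s - ε / 2) / (ε / 2)))| ≤ 1 := fun s => by
        rw [abs_of_nonneg (le_max_left _ _)]
        exact max_le zero_le_one (min_le_left _ _)
      obtain ⟨m, hm⟩ : ∃ m : C₀(ℝ, ℂ), ∀ s, m s = k s *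
          (max 0 (min 1 ((-s - ε / 2) / (ε / 2))) : ℝ) := ⟨⟨⟨fun s => k s * (max 0 (min 1 ((-s - ε / 2) / (ε / 2))) : ℝ),
        by fun_prop⟩, by
        refine squeeze_zero_norm (fun s => ?_) hnorm
        change ‖k s * _‖ ≤ ‖k s‖
        rw [norm_mul, Complex.norm_real, Real.norm_eq_abs]
        exact mul_le_of_le_one_right (norm_nonneg _) (hχ s)⟩, fun _ => rfl⟩
      have hm0 : ∀ s, -(ε / 2) ≤ s → m s = 0 := fun s hs => by
        rw [hm, max_eq_left, Complex.ofReal_zero, mul_zero]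
        exact (min_le_right _ _).trans
          (div_nonpos_of_nonpos_of_nonneg (by linarith) (by linarith))
      have hsplit : functionalCalculus A (k - n) = functionalCalculus A m := by
        refine functionalCalculus_congr hA fun s hs => ?_
        rw [ZeroAtInftyContinuousMap.sub_apply, hn]
        rcases le_or_gt 0 s with h | h
        · rw [max_eq_left h, sub_self, hm0 s (by linarith)]
        · have hsε : s ≤ -ε := by
            by_contra hlt
            exact hgap s h.ne (by rw [abs_of_neg h]; linarith) hs
          have h1 : (1 : ℝ) ≤ (-s - ε / 2) / (ε / 2) := by
            rw [le_div_iff₀ (by linarith)]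
            linarith
          rw [max_eq_right h.le, hk0, hm, min_eq_left h1, max_eq_right zero_le_one]
          simp
      have hny : functionalCalculus A n y = 0 := by
        have : y ∈ (⊤ : Submodule ℂ H) := trivial
        rw [← hL, mem_spectralSubspace isClosed_Icc] at this
        refine this n fun s hs => ?_
        rw [hn]
        exact hk _ ⟨le_max_right _ _, max_le hs.2 (not_lt.1 hL0)⟩
      have hmy : functionalCalculus A m y = 0 := by
        refine ext_inner_right ℂ fun z => ?_
        rw [hstar, inner_zero_left]
        refine (Submodule.mem_orthogonal' _ _).1 hy _ ?_
        have hmem := functionalCalculus_mem hA (K := Set.Iic (-(ε / 2))) (f := star m)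
          (fun s hs => by
            rw [ZeroAtInftyContinuousMap.star_apply, hm0 s (not_le.1 hs).le, star_zero]) z
        rw [← spectralSubspace_eq isClosed_Iic] at hmem
        exact spectralSubspace_mono (Set.Iic_subset_Iio.2 (by linarith)) hmem
      rw [functionalCalculus_sub hA] at hsplit
      have h1 : functionalCalculus A k y - functionalCalculus A n y = functionalCalculus A m y :=
        congrArg (fun T : H →L[ℂ] H => T y) hsplit
      rwa [hny, hmy, sub_zero] at h1
  rw [key]
  exact Submodule.isCompl_orthogonal _

lemma sf_finiteDimensional {A : unitInterval → H →ₗ.[ℂ] H} (hA : IsFredholmFamily γ A) :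
    sf γ A = traceOn γ.toLinearMap (spectralSubspace (A 0) (Set.Iio 0)) -
      traceOn γ.toLinearMap (spectralSubspace (A 1) (Set.Iio 0)) := by
  -- Near `t₀` the spectral subspace for `[-(L+1), L+1]` is all of `H`, so the traces on `(-∞,0)`
  -- and on `[0, L+1]` add up to the constant trace of `γ` on `H`.
  have hpot : IsFlowPotential γ A fun t =>
      -traceOn γ.toLinearMap (spectralSubspace (A t) (Set.Iio 0)) := by
    intro t₀
    obtain ⟨L, hL, hbound⟩ := exists_spectrum_bound (hA.selfAdjoint t₀)
    obtain ⟨f, g, hfg⟩ := hA.exists_eventually_isCutoff (x₀ := t₀) (a := L) (c := L + 1)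
      (b := L + 2) (by linarith) (by linarith) fun s hs _ hmem => absurd (hbound s hmem) hs.not_gt
    have hcont := hA.continuousAt_spectralProjection hfg
    have htop : spectralSubspace (A t₀) (Set.Icc (-(L + 1)) (L + 1)) = ⊤ := by
      rw [eq_top_iff]
      intro x _
      refine (mem_spectralSubspace isClosed_Icc).2 fun k hk => ?_
      have : functionalCalculus (A t₀) k = functionalCalculus (A t₀) ((0 : ℂ) • k) := by
        refine functionalCalculus_congr (hA.selfAdjoint t₀) fun s hs => ?_
        rw [hk s (abs_le.1 (by linarith [hbound s hs])), zero_smul]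
        rfl
      rw [this, functionalCalculus_smul (hA.selfAdjoint t₀), zero_smul]
      rfl
    have key := eventually_exists_equiv hcont
      (Eventually.of_forall fun x => (spectralSubspace (A x)
        (Set.Icc (-(L + 1)) (L + 1))).isIdempotentElem_starProjection)
      (G := 1) (Eventually.of_forall fun x => Commute.one_right _)
    have htop' : ∀ᶠ t in 𝓝 t₀, spectralSubspace (A t) (Set.Icc (-(L + 1)) (L + 1)) = ⊤ := by
      filter_upwards [key] with t ht
      obtain ⟨e, -, he⟩ := ht
      simp only [spectralProjection, Submodule.range_starProjection, htop] at he
      rw [← he, Submodule.map_top, LinearEquiv.range]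
    have hsum : ∀ t, spectralSubspace (A t) (Set.Icc (-(L + 1)) (L + 1)) = ⊤ →
        traceOn γ.toLinearMap (spectralSubspace (A t) (Set.Iio 0)) +
          spectralTrace γ (A t) (L + 1) = traceOn γ.toLinearMap ⊤ := by
      intro t ht
      have hc := isCompl_spectralSubspace (hA.selfAdjoint t) (hA.fredholm t) ht
      rw [spectralTrace, ← hc.sup_eq_top, traceOn_sup
        (map_mem_spectralSubspace (hA.selfAdjoint t) (hA.commutes t))
        (map_mem_spectralSubspace (hA.selfAdjoint t) (hA.commutes t)) hc.disjoint]
    filter_upwards [hA.eventually_spectralTrace_sub (by linarith) inferInstance hcont] with c hc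
    filter_upwards [hc, htop'] with t ht ht'
    linear_combination ht - hsum t ht' + hsum t₀ htop
  rw [hpot.sf_eq hA]
  ring

end FiniteDimensional

/-! ### Direct sums -/

section DirectSum

variable {H : Type u} [NormedAddCommGroup H] [InnerProductSpace ℂ H]
  {K : Type v} [NormedAddCommGroup K] [InnerProductSpace ℂ K]
  {A : H →ₗ.[ℂ] H} {B : K →ₗ.[ℂ] K}

lemma mem_graph_directSum {z : WithLp 2 (H × K) × WithLp 2 (H × K)} :
    z ∈ (directSum A B).graph ↔
      (z.1.fst, z.2.fst) ∈ A.graph ∧ (z.1.snd, z.2.snd) ∈ B.graph := by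
  simp only [LinearPMap.mem_graph_iff]
  constructor
  · rintro ⟨⟨y, hy⟩, h1, h2⟩
    exact ⟨⟨⟨y.fst, hy.1⟩, by rw [← h1], by rw [← h2]; rfl⟩,
      ⟨⟨y.snd, hy.2⟩, by rw [← h1], by rw [← h2]; rfl⟩⟩
  · rintro ⟨⟨⟨a, ha⟩, h1, h2⟩, ⟨⟨b, hb⟩, h3, h4⟩⟩
    have h1' : a = z.1.fst := h1
    have h3' : b = z.1.snd := h3
    subst h1' h3'
    refine ⟨⟨z.1, ha, hb⟩, rfl, ?_⟩
    change WithLp.toLp 2 (A ⟨_, ha⟩, B ⟨_, hb⟩) = z.2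
    rw [h2, h4]
    rfl

/-- The inclusion of the first summand into the orthogonal direct sum. -/
def inlL (H : Type u) (K : Type v) [NormedAddCommGroup H] [InnerProductSpace ℂ H]
    [NormedAddCommGroup K] [InnerProductSpace ℂ K] : H →L[ℂ] WithLp 2 (H × K) :=
  (WithLp.prodContinuousLinearEquiv 2 ℂ H K).symm.toContinuousLinearMap ∘L
    ContinuousLinearMap.inl ℂ H K

/-- The inclusion of the second summand into the orthogonal direct sum. -/
def inrL (H : Type u) (K : Type v) [NormedAddCommGroup H] [InnerProductSpace ℂ H]
    [NormedAddCommGroup K] [InnerProductSpace ℂ K] : K →L[ℂ] WithLp 2 (H × K) :=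
  (WithLp.prodContinuousLinearEquiv 2 ℂ H K).symm.toContinuousLinearMap ∘L
    ContinuousLinearMap.inr ℂ H K

@[simp] lemma inlL_fst (x : H) : (inlL H K x).fst = x := rfl
@[simp] lemma inlL_snd (x : H) : (inlL H K x).snd = 0 := rfl
@[simp] lemma inrL_fst (x : K) : (inrL H K x).fst = 0 := rfl
@[simp] lemma inrL_snd (x : K) : (inrL H K x).snd = x := rfl

lemma inlL_add_inrL (z : WithLp 2 (H × K)) : inlL H K z.fst + inrL H K z.snd = z := by
  apply (WithLp.linearEquiv 2 ℂ (H × K)).injective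
  ext
  · exact add_zero _
  · exact zero_add _

lemma inlL_mem_graph {z : H × H} (hz : z ∈ A.graph) :
    (inlL H K z.1, inlL H K z.2) ∈ (directSum A B).graph :=
  mem_graph_directSum.2 ⟨hz, B.graph.zero_mem⟩

lemma inrL_mem_graph {z : K × K} (hz : z ∈ B.graph) :
    (inrL H K z.1, inrL H K z.2) ∈ (directSum A B).graph :=
  mem_graph_directSum.2 ⟨A.graph.zero_mem, hz⟩

lemma dense_domain_directSum (hA : Dense (A.domain : Set H)) (hB : Dense (B.domain : Set K)) :
    Dense ((directSum A B).domain : Set (WithLp 2 (H × K))) :=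
  (hA.prod hB).preimage
    (WithLp.prodContinuousLinearEquiv 2 ℂ H K).toHomeomorph.isOpenMap

variable [CompleteSpace H] [CompleteSpace K]

lemma mem_kernel_directSum {z : WithLp 2 (H × K)} :
    z ∈ kernel (directSum A B) ↔ z.fst ∈ kernel A ∧ z.snd ∈ kernel B := by
  rw [mem_kernel, mem_kernel, mem_kernel, mem_graph_directSum]
  rfl

lemma kernel_directSum_le :
    kernel (directSum A B) ≤ (kernel A).map (inlL H K).toLinearMap ⊔
      (kernel B).map (inrL H K).toLinearMap := by
  intro z hz
  have h := mem_kernel_directSum.1 hz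
  rw [Submodule.mem_sup]
  exact ⟨inlL H K z.fst, Submodule.mem_map_of_mem h.1, inrL H K z.snd,
    Submodule.mem_map_of_mem h.2, inlL_add_inrL z⟩

lemma mem_range_directSum {z : WithLp 2 (H × K)} :
    z ∈ LinearMap.range (directSum A B).toFun ↔
      z.fst ∈ LinearMap.range A.toFun ∧ z.snd ∈ LinearMap.range B.toFun := by
  constructor
  · rintro ⟨⟨y, hy⟩, rfl⟩
    exact ⟨⟨⟨y.fst, hy.1⟩, rfl⟩, ⟨⟨y.snd, hy.2⟩, rfl⟩⟩
  · rintro ⟨⟨⟨a, ha⟩, h1⟩, ⟨⟨b, hb⟩, h2⟩⟩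
    refine ⟨⟨WithLp.toLp 2 (a, b), ha, hb⟩, ?_⟩
    change WithLp.toLp 2 (A ⟨_, ha⟩, B ⟨_, hb⟩) = z
    have h1' : A ⟨a, ha⟩ = z.fst := h1
    have h2' : B ⟨b, hb⟩ = z.snd := h2
    rw [h1', h2']
    rfl

lemma isSelfAdjoint_directSum (hA : IsSelfAdjoint A) (hB : IsSelfAdjoint B) :
    IsSelfAdjoint (directSum A B) := by
  rw [LinearPMap.isSelfAdjoint_def]
  apply LinearPMap.eq_of_eq_graph
  rw [LinearPMap.adjoint_graph_eq_graph_adjoint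
    (dense_domain_directSum hA.dense_domain hB.dense_domain)]
  ext z
  rw [Submodule.mem_adjoint_iff, mem_graph_directSum]
  constructor
  · intro h
    constructor
    · refine mem_graph_of_forall_inner hA fun x hx => ?_
      have := h _ _ (inlL_mem_graph (B := B) hx)
      rw [WithLp.prod_inner_apply, WithLp.prod_inner_apply] at this
      have h2 : ⟪x.2, z.1.fst⟫_ℂ + ⟪(0 : K), z.1.snd⟫_ℂ -
        (⟪x.1, z.2.fst⟫_ℂ + ⟪(0 : K), z.2.snd⟫_ℂ) = 0 := this
      rw [inner_zero_left, inner_zero_left, add_zero, add_zero, sub_eq_zero] at h2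
      rw [← inner_conj_symm, ← h2, inner_conj_symm]
    · refine mem_graph_of_forall_inner hB fun x hx => ?_
      have := h _ _ (inrL_mem_graph (A := A) hx)
      rw [WithLp.prod_inner_apply, WithLp.prod_inner_apply] at this
      have h2 : ⟪(0 : H), z.1.fst⟫_ℂ + ⟪x.2, z.1.snd⟫_ℂ -
        (⟪(0 : H), z.2.fst⟫_ℂ + ⟪x.1, z.2.snd⟫_ℂ) = 0 := this
      rw [inner_zero_left, inner_zero_left, zero_add, zero_add, sub_eq_zero] at h2
      rw [← inner_conj_symm, ← h2, inner_conj_symm]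
  · rintro ⟨h1, h2⟩ a b hab
    obtain ⟨h3, h4⟩ := mem_graph_directSum.1 hab
    rw [WithLp.prod_inner_apply, WithLp.prod_inner_apply]
    have e1 := graph_symm hA h3 h1
    have e2 := graph_symm hB h4 h2
    change ⟪b.fst, z.1.fst⟫_ℂ + ⟪b.snd, z.1.snd⟫_ℂ -
      (⟪a.fst, z.2.fst⟫_ℂ + ⟪a.snd, z.2.snd⟫_ℂ) = 0
    linear_combination e1 + e2

lemma isFredholm_directSum (hA : IsSelfAdjoint A) (hB : IsSelfAdjoint B) (hFA : IsFredholm A)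
    (hFB : IsFredholm B) : IsFredholm (directSum A B) where
  isClosed := (isSelfAdjoint_directSum hA hB).isClosed
  dense := dense_domain_directSum hFA.dense hFB.dense
  finite_ker := by
    have := hFA.finite_ker
    have := hFB.finite_ker
    have : FiniteDimensional ℂ (kernel A) := by unfold kernel; infer_instance
    have : FiniteDimensional ℂ (kernel B) := by unfold kernel; infer_instance
    have : FiniteDimensional ℂ ((LinearMap.ker (directSum A B).toFun).map
        (directSum A B).domain.subtype) :=
      Submodule.finiteDimensional_of_le kernel_directSum_le
    exact LinearEquiv.finiteDimensional (Submodule.equivMapOfInjective _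
      (Submodule.injective_subtype _) (LinearMap.ker (directSum A B).toFun)).symm
  isClosed_range := by
    have : (LinearMap.range (directSum A B).toFun : Set (WithLp 2 (H × K))) =
        WithLp.prodContinuousLinearEquiv 2 ℂ H K ⁻¹'
          ((LinearMap.range A.toFun : Set H) ×ˢ (LinearMap.range B.toFun : Set K)) := by
      ext z
      exact mem_range_directSum
    rw [this]
    exact (hFA.isClosed_range.prod hFB.isClosed_range).preimage
      (WithLp.prodContinuousLinearEquiv 2 ℂ H K).continuous
  finite_coker := by
    have := hFA.finite_coker
    have := hFB.finite_coker
    let q : WithLp 2 (H × K) →ₗ[ℂ]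
        (H ⧸ LinearMap.range A.toFun) × (K ⧸ LinearMap.range B.toFun) :=
      (LinearMap.prodMap (Submodule.mkQ _) (Submodule.mkQ _)) ∘ₗ
        (WithLp.linearEquiv 2 ℂ (H × K)).toLinearMap
    have hq : LinearMap.ker q = LinearMap.range (directSum A B).toFun := by
      ext z
      rw [mem_range_directSum, LinearMap.mem_ker]
      change ((Submodule.Quotient.mk z.fst, Submodule.Quotient.mk z.snd) :
        (H ⧸ LinearMap.range A.toFun) × (K ⧸ LinearMap.range B.toFun)) = 0 ↔ _
      rw [Prod.mk_eq_zero, Submodule.Quotient.mk_eq_zero, Submodule.Quotient.mk_eq_zero]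
    rw [← hq]
    exact LinearEquiv.finiteDimensional q.quotKerEquivRange.symm

lemma commutes_directSum {γ : H ≃ₗᵢ[ℂ] H} {δ : K ≃ₗᵢ[ℂ] K} (hA : Commutes γ A)
    (hB : Commutes δ B) :
    Commutes (LinearIsometryEquiv.withLpProdCongr 2 γ δ) (directSum A B) where
  mem_domain_iff x := and_congr (hA.mem_domain_iff x.fst) (hB.mem_domain_iff x.snd)
  map_apply x hx hγx := by
    exact congrArg (WithLp.toLp 2) (Prod.ext (hA.map_apply x.fst hx.1 hγx.1)
      (hB.map_apply x.snd hx.2 hγx.2))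

/-- The operator `(x, y) ↦ (V x, V y)` on the square of a Hilbert space. -/
def squareL {L M : Type*} [NormedAddCommGroup L] [InnerProductSpace ℂ L]
    [NormedAddCommGroup M] [InnerProductSpace ℂ M] (V : L →L[ℂ] M) :
    WithLp 2 (L × L) →L[ℂ] WithLp 2 (M × M) :=
  (WithLp.prodContinuousLinearEquiv 2 ℂ M M).symm.toContinuousLinearMap ∘L
    (V ∘L WithLp.fstL 2 ℂ L L).prod (V ∘L WithLp.sndL 2 ℂ L L)

/-- The graph of the sum is the orthogonal sum of the two graphs after the swap `(H ⊕ K)² ≅ H² ⊕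
K²`. Gap continuity of the sum can be read off from the formula. -/
lemma starProjection_directSum (hA : IsSelfAdjoint A) (hB : IsSelfAdjoint B) :
    (closedGraph (directSum A B)).starProjection =
      squareL (inlL H K) ∘L (closedGraph A).starProjection ∘L squareL (WithLp.fstL 2 ℂ H K) +
      squareL (inrL H K) ∘L (closedGraph B).starProjection ∘L squareL (WithLp.sndL 2 ℂ H K) := by
  ext1 z
  set a := (closedGraph A).starProjection (squareL (WithLp.fstL 2 ℂ H K) z) with ha
  set b := (closedGraph B).starProjection (squareL (WithLp.sndL 2 ℂ H K) z) with hb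
  have ha' : (a.fst, a.snd) ∈ A.graph :=
    (mem_closedGraph hA.isClosed).1 (Submodule.starProjection_apply_mem _ _)
  have hb' : (b.fst, b.snd) ∈ B.graph :=
    (mem_closedGraph hB.isClosed).1 (Submodule.starProjection_apply_mem _ _)
  change _ = squareL (inlL H K) a + squareL (inrL H K) b
  have hAB := (isSelfAdjoint_directSum hA hB).isClosed
  refine Submodule.eq_starProjection_of_mem_of_inner_eq_zero ?_ fun w hw => ?_
  · exact Submodule.add_mem _ ((mem_closedGraph hAB).2 (inlL_mem_graph ha'))
      ((mem_closedGraph hAB).2 (inrL_mem_graph hb'))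
  · obtain ⟨h1, h2⟩ := mem_graph_directSum.1 ((mem_closedGraph hAB).1 hw)
    have e1 := Submodule.starProjection_inner_eq_zero (K := closedGraph A)
      (squareL (WithLp.fstL 2 ℂ H K) z) (WithLp.toLp 2 (w.fst.fst, w.snd.fst))
      ((mem_closedGraph hA.isClosed).2 h1)
    have e2 := Submodule.starProjection_inner_eq_zero (K := closedGraph B)
      (squareL (WithLp.sndL 2 ℂ H K) z) (WithLp.toLp 2 (w.fst.snd, w.snd.snd))
      ((mem_closedGraph hB.isClosed).2 h2)
    rw [← ha, WithLp.prod_inner_apply] at e1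
    rw [← hb, WithLp.prod_inner_apply] at e2
    have e1' : ⟪z.fst.fst - a.fst, w.fst.fst⟫_ℂ + ⟪z.snd.fst - a.snd, w.snd.fst⟫_ℂ = 0 := e1
    have e2' : ⟪z.fst.snd - b.fst, w.fst.snd⟫_ℂ + ⟪z.snd.snd - b.snd, w.snd.snd⟫_ℂ = 0 := e2
    rw [WithLp.prod_inner_apply, WithLp.prod_inner_apply, WithLp.prod_inner_apply]
    change ⟪z.fst.fst - (a.fst + 0), w.fst.fst⟫_ℂ + ⟪z.fst.snd - (0 + b.fst), w.fst.snd⟫_ℂ +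
      (⟪z.snd.fst - (a.snd + 0), w.snd.fst⟫_ℂ + ⟪z.snd.snd - (0 + b.snd), w.snd.snd⟫_ℂ) = 0
    rw [add_zero, add_zero, zero_add, zero_add]
    linear_combination e1' + e2'

lemma functionalCalculus_directSum (hA : IsSelfAdjoint A) (hB : IsSelfAdjoint B)
    (f : C₀(ℝ, ℂ)) (z : WithLp 2 (H × K)) : functionalCalculus (directSum A B) f z =
      inlL H K (functionalCalculus A f z.fst) + inrL H K (functionalCalculus B f z.snd) := by
  have hAB := isSelfAdjoint_directSum hA hB
  rw [map_functionalCalculus hA hAB (fun _ hz => inlL_mem_graph hz),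
    map_functionalCalculus hB hAB (fun _ hz => inrL_mem_graph hz), ← map_add, inlL_add_inrL]

lemma mem_spectralSubspace_directSum (hA : IsSelfAdjoint A) (hB : IsSelfAdjoint B) {S : Set ℝ}
    (hS : IsClosed S) {z : WithLp 2 (H × K)} : z ∈ spectralSubspace (directSum A B) S ↔
      z.fst ∈ spectralSubspace A S ∧ z.snd ∈ spectralSubspace B S := by
  simp only [mem_spectralSubspace hS, functionalCalculus_directSum hA hB]
  rw [← forall₂_and]
  refine forall₂_congr fun f _ => ⟨fun h => ?_, fun ⟨h1, h2⟩ => ?_⟩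
  · have h1 := congrArg WithLp.fst h
    have h2 := congrArg WithLp.snd h
    simp only [WithLp.add_fst, WithLp.add_snd, inlL_fst, inlL_snd, inrL_fst, inrL_snd, add_zero,
      zero_add] at h1 h2
    exact ⟨h1, h2⟩
  · rw [h1, h2, map_zero, map_zero, add_zero]

lemma spectralTrace_directSum {γ : H ≃ₗᵢ[ℂ] H} {δ : K ≃ₗᵢ[ℂ] K} (hA : IsSelfAdjoint A)
    (hB : IsSelfAdjoint B) (hγ : Commutes γ A) (hδ : Commutes δ B) {c : ℝ}
    (h1 : FiniteDimensional ℂ (spectralSubspace A (Set.Icc 0 c)))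
    (h2 : FiniteDimensional ℂ (spectralSubspace B (Set.Icc 0 c))) :
    spectralTrace (LinearIsometryEquiv.withLpProdCongr 2 γ δ) (directSum A B) c =
      spectralTrace γ A c + spectralTrace δ B c := by
  have hmem := fun z => mem_spectralSubspace_directSum hA hB (isClosed_Icc (a := 0) (b := c))
    (z := z)
  let e : (spectralSubspace A (Set.Icc 0 c) × spectralSubspace B (Set.Icc 0 c)) ≃ₗ[ℂ]
      spectralSubspace (directSum A B) (Set.Icc 0 c) :=
    { toFun := fun x => ⟨WithLp.toLp 2 (x.1, x.2), (hmem _).2 ⟨x.1.2, x.2.2⟩⟩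
      invFun := fun z => (⟨_, ((hmem z).1 z.2).1⟩, ⟨_, ((hmem z).1 z.2).2⟩)
      map_add' := fun _ _ => rfl
      map_smul' := fun _ _ => rfl
      left_inv := fun _ => rfl
      right_inv := fun _ => rfl }
  exact traceOn_prod (map_mem_spectralSubspace hA hγ) (map_mem_spectralSubspace hB hδ) e
    fun _ _ => rfl

end DirectSum

section DirectSumFamilies

variable {H : Type u} [NormedAddCommGroup H] [InnerProductSpace ℂ H] [CompleteSpace H]
  {K : Type v} [NormedAddCommGroup K] [InnerProductSpace ℂ K] [CompleteSpace K]
  {γ : H ≃ₗᵢ[ℂ] H} {δ : K ≃ₗᵢ[ℂ] K}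

lemma IsFredholmFamily.directSum {X : Type*} [TopologicalSpace X] {A : X → H →ₗ.[ℂ] H}
    {B : X → K →ₗ.[ℂ] K} (hA : IsFredholmFamily γ A) (hB : IsFredholmFamily δ B) :
    IsFredholmFamily (LinearIsometryEquiv.withLpProdCongr 2 γ δ)
      fun x => directSum (A x) (B x) where
  selfAdjoint x := isSelfAdjoint_directSum (hA.selfAdjoint x) (hB.selfAdjoint x)
  fredholm x := isFredholm_directSum (hA.selfAdjoint x) (hB.selfAdjoint x) (hA.fredholm x)
    (hB.fredholm x)
  commutes x := commutes_directSum (hA.commutes x) (hB.commutes x)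
  gapContinuous := by
    rw [gapContinuous_iff]
    simp only [starProjection_directSum (hA.selfAdjoint _) (hB.selfAdjoint _)]
    have h1 := gapContinuous_iff.1 hA.gapContinuous
    have h2 := gapContinuous_iff.1 hB.gapContinuous
    exact (continuous_const.clm_comp (h1.clm_comp continuous_const)).add
      (continuous_const.clm_comp (h2.clm_comp continuous_const))

/-- Provides the finite-dimensionality under which `spectralTrace` is additive on direct sums,
uniformly near `x₀`. -/
lemma IsFredholmFamily.eventually_finiteDimensional_Icc {X : Type*} [TopologicalSpace X]
    {A : X → H →ₗ.[ℂ] H} (hA : IsFredholmFamily γ A) (x₀ : X) :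
    ∀ᶠ c in 𝓝[>] (0 : ℝ), ∀ᶠ x in 𝓝 x₀,
      FiniteDimensional ℂ (spectralSubspace (A x) (Set.Icc 0 c)) := by
  obtain ⟨a, ha, hev⟩ := hA.exists_finite_continuousAt x₀
  filter_upwards [Ioo_mem_nhdsGT ha] with c hc
  filter_upwards [hev] with x hx
  have := hx.1
  exact Submodule.finiteDimensional_of_le
    (spectralSubspace_mono (K := Set.Icc 0 c) (L := Set.Icc (-a) a)
      (Set.Icc_subset_Icc (by linarith) hc.2.le))

lemma sf_directSum {A : unitInterval → H →ₗ.[ℂ] H} {B : unitInterval → K →ₗ.[ℂ] K}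
    (hA : IsFredholmFamily γ A) (hB : IsFredholmFamily δ B) :
    sf (LinearIsometryEquiv.withLpProdCongr 2 γ δ) (fun t => directSum (A t) (B t)) =
      sf γ A + sf δ B := by
  obtain ⟨Φ, hΦ⟩ := hA.exists_isFlowPotential
  obtain ⟨Ψ, hΨ⟩ := hB.exists_isFlowPotential
  have h : IsFlowPotential (LinearIsometryEquiv.withLpProdCongr 2 γ δ)
      (fun t => directSum (A t) (B t)) fun t => Φ t + Ψ t := by
    intro t₀
    filter_upwards [hΦ t₀, hΨ t₀, hA.eventually_finiteDimensional_Icc t₀,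
      hB.eventually_finiteDimensional_Icc t₀] with c h1 h2 h3 h4
    have h5 : ∀ᶠ t in 𝓝 t₀, spectralTrace (LinearIsometryEquiv.withLpProdCongr 2 γ δ)
        (directSum (A t) (B t)) c = spectralTrace γ (A t) c + spectralTrace δ (B t) c := by
      filter_upwards [h3, h4] with t h3t h4t
      exact spectralTrace_directSum (hA.selfAdjoint t) (hB.selfAdjoint t) (hA.commutes t)
        (hB.commutes t) h3t h4t
    filter_upwards [h1, h2, h5] with t h1t h2t h5t
    rw [h5t, h5.self_of_nhds]
    linear_combination h1t + h2t
  rw [h.sf_eq (hA.directSum hB), hΦ.sf_eq hA, hΨ.sf_eq hB]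
  ring

end DirectSumFamilies

end SpectralFlow

end

open SpectralFlow in
theorem theorem3p9 {H : Type*} [NormedAddCommGroup H] [InnerProductSpace ℂ H] [CompleteSpace H]
    {K : Type*} [NormedAddCommGroup K] [InnerProductSpace ℂ K] [CompleteSpace K]
    (γ : H ≃ₗᵢ[ℂ] H) (δ : K ≃ₗᵢ[ℂ] K) :
    -- the spectral flow is well defined: flow partitions exist and all give the same value
    (∀ A : unitInterval → H →ₗ.[ℂ] H, IsFredholmFamily γ A →
      Nonempty (FlowPartition A) ∧ ∀ p : FlowPartition A, p.flow γ = sf γ A) ∧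
    -- families of invertible operators
    (∀ A : unitInterval → H →ₗ.[ℂ] H, IsFredholmFamily γ A →
      (∀ t, Function.Bijective (A t)) → sf γ A = 0) ∧
    -- direct sums
    (∀ (A : unitInterval → H →ₗ.[ℂ] H) (B : unitInterval → K →ₗ.[ℂ] K),
      IsFredholmFamily γ A → IsFredholmFamily δ B →
      IsFredholmFamily (LinearIsometryEquiv.withLpProdCongr 2 γ δ)
          (fun t => directSum (A t) (B t)) ∧
        sf (LinearIsometryEquiv.withLpProdCongr 2 γ δ) (fun t => directSum (A t) (B t)) =
          sf γ A + sf δ B) ∧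
    -- homotopies with fixed endpoints
    (∀ A : unitInterval × unitInterval → H →ₗ.[ℂ] H, IsFredholmFamily γ A →
      (∀ s, A (0, s) = A (0, 0)) → (∀ s, A (1, s) = A (1, 0)) →
      sf γ (fun t => A (t, 1)) = sf γ (fun t => A (t, 0))) ∧
    -- finite-dimensional spaces
    (FiniteDimensional ℂ H → ∀ A : unitInterval → H →ₗ.[ℂ] H, IsFredholmFamily γ A →
      sf γ A = traceOn γ.toLinearMap (spectralSubspace (A 0) (Set.Iio 0)) -
        traceOn γ.toLinearMap (spectralSubspace (A 1) (Set.Iio 0))) ∧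
    -- concatenations
    (∀ A B : unitInterval → H →ₗ.[ℂ] H, IsFredholmFamily γ A → IsFredholmFamily γ B → A 1 = B 0 →
      IsFredholmFamily γ (concat A B) ∧ sf γ (concat A B) = sf γ A + sf γ B) := by
  refine ⟨fun A hA => ⟨hA.nonempty_flowPartition, fun p => ?_⟩, fun A hA hbij => ?_,
    fun A B hA hB => ⟨hA.directSum hB, sf_directSum hA hB⟩, fun A hA h0 h1 => sf_homotopy hA h0 h1,
    fun _ A hA => sf_finiteDimensional hA,
    fun A B hA hB hAB => ⟨hA.concat hB hAB, sf_concat hA hB hAB⟩⟩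
  · obtain ⟨Φ, hΦ⟩ := hA.exists_isFlowPotential
    rw [p.flow_eq hA hΦ, hΦ.sf_eq hA]
  · rw [(hA.isFlowPotential_zero fun t => (hbij t).1).sf_eq hA, sub_self]
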